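/- Let $\mathfrak g=\mathfrak g_1\oplus\mathfrak g_2$ be a direct sum of three-dimensional real Lie algebras. An $\mathrm{SL}(3,\mathbb R)$-structure $(g,J,\omega,\Psi)$ on $\mathfrak g$ consists of a neutral scalar product $g$, an endomorphism $J$ with $J^2=\mathrm{id}$ and $g(J\cdot,J\cdot)=-g$, the two-form $\omega=g(\cdot,J\cdot)$, and a $(3,0)$-form $\Psi$ of non-zero length with values in the para-complex numbers $\mathbb R[\mathrm e]$, $\mathrm e^2=1$ (that is, $\Psi(JX,Y,Z)=\mathrm e\,\Psi(X,Y,Z)$). It is half-flat if $d(\operatorname{Re}\Psi)=0$ and $d(\omega\wedge\omega)=0$, where $d$ is the Chevalley–Eilenberg differential, $d\alpha(X,Y)=-\alpha([X,Y])$ on one-forms. Suppose that $\mathfrak g_1\perp\mathfrak g_2$ and that $g$ is definite on each summand. The para-Hermitian structure $(g,J,\omega)$ is said to be of type I (respectively type II) if, for $a=0$ (respectively for some real $a\neq0$), there are pseudo-orthonormal bases $e_1,e_2,e_3$ of $\mathfrak g_1$ and $f_1,f_2,f_3$ of $\mathfrak g_2$ (with dual bases $e^i$, $f^i$) such that $$\omega=a\,e^{12}+\sqrt{1+a^2}\,e^1\wedge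 f^1+\sqrt{1+a^2}\,e^2\wedge f^2+e^3\wedge f^3+a\,f^{12}.$$ Then $\mathfrak g$ admits a half-flat $\mathrm{SL}(3,\mathbb R)$-structure such that $\mathfrak g_1$ and $\mathfrak g_2$ are mutually orthogonal, the restriction of the metric to both summands is definite, and the underlying para-Hermitian structure is of type I, if and only if (i) $\mathfrak g_1\cong\mathfrak g_2$ and both are unimodular, or (ii) one of $\mathfrak g_1,\mathfrak g_2$ is non-abelian unimodular and the other is abelian. Moreover, $\mathfrak g$ admits a half-flat $\mathrm{SL}(3,\mathbb R)$-structure such that $\mathfrak g_1$ and $\mathfrak g_2$ are mutually orthogonal, the restriction of the metric to both summands is definite, and the underlying para-Hermitian structure is of type II, if and only if $\mathfrak g$ is abelian or, up to isomorphism of each summand, the pair $(\mathfrak g_1,\mathfrak g_2)$ or $(\mathfrak g_2,\mathfrak g_1)$ is contained in the following list: $$(\mathfrak e(1,1),\mathfrak e(1,1)),\qquad (\mathfrak e(2),\mathbb R\oplus\mathfrak r_2),\qquad (\mathfrak{su}(2),\mathfrak r_{3,\mu})\ \ (0<\mu\le1),\qquad (\mathfrak{sl}(2,\mathbb R),\mathfrak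 r_{3,\mu})\ \ (-1<\mu<0).$$ Here the Lie algebras are given in a suitable basis $(e^i)$ of the dual space, with omitted differentials equal to zero, by: $\mathfrak{su}(2)$: $de^1=e^{23},\ de^2=e^{31},\ de^3=e^{12}$; $\mathfrak{sl}(2,\mathbb R)$: $de^1=e^{23},\ de^2=e^{31},\ de^3=e^{21}$; $\mathfrak e(2)$: $de^2=e^{31},\ de^3=e^{12}$; $\mathfrak e(1,1)$: $de^2=e^{31},\ de^3=e^{21}$; $\mathbb R\oplus\mathfrak r_2$: $de^2=e^{21}$; $\mathfrak r_{3,\mu}$: $de^2=e^{21},\ de^3=\mu\,e^{31}$. -/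

import Mathlib

open scoped BigOperators

/-- The para-complex numbers `a + e b` with `e² = 1`. -/
abbrev ParaComplex : Type := QuadraticAlgebra ℝ 1 0

namespace ParaComplex

/-- The para-complex unit `e`. -/
def e : ParaComplex := ⟨0, 1⟩

/-- The real part, as a linear map. -/
def reLin : ParaComplex →ₗ[ℝ] ℝ where
  toFun z := z.re
  map_add' _ _ := rfl
  map_smul' _ _ := rfl

end ParaComplex

section Forms

variable {V : Type*} [AddCommGroup V] [Module ℝ V]

/-- The wedge product of real exterior forms (the sum over shuffles of signed products). -/
noncomputable def formWedge {p q : ℕ} (α : V [⋀^Fin p]→ₗ[ℝ] ℝ) (β : V [⋀^Fin q]→ₗ[ℝ] ℝ) :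
    V [⋀^Fin (p + q)]→ₗ[ℝ] ℝ :=
  ((LinearMap.mul' ℝ ℝ).compAlternatingMap (α.domCoprod β)).domDomCongr finSumFinEquiv

/-- A pseudo-orthonormal basis `η₁, …, η₆` of a neutral metric in dimension six:
the first three vectors have square `1`, the last three have square `-1`. -/
def IsNeutralBasis (g : LinearMap.BilinForm ℝ V) (b : Module.Basis (Fin 3 ⊕ Fin 3) ℝ V) : Prop :=
  (∀ i j : Fin 3, g (b (Sum.inl i)) (b (Sum.inl j)) = if i = j then 1 else 0) ∧
  (∀ i j : Fin 3, g (b (Sum.inr i)) (b (Sum.inr j)) = if i = j then -1 else 0) ∧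
  (∀ i j : Fin 3, g (b (Sum.inl i)) (b (Sum.inr j)) = 0)

/-- The squared length `g(Ψ, Ψ̄)` of a para-complex three-form, computed in a pseudo-orthonormal
basis: the sum over `i < j < k` of `εᵢ εⱼ εₖ Ψ(bᵢ,bⱼ,bₖ) · conj Ψ(bᵢ,bⱼ,bₖ)` with
`εᵢ = g(bᵢ,bᵢ) = ±1`, written as a sixth of the sum over all triples. (In `ParaComplex` one has
`norm z = z · conj z = (re z)² - (im z)²`.) The value does not depend on the basis. -/
noncomputable def lengthSq (g : LinearMap.BilinForm ℝ V)
    (b : Module.Basis (Fin 3 ⊕ Fin 3) ℝ V) (Ψ : V [⋀^Fin 3]→ₗ[ℝ] ParaComplex) : ℝ :=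
  (1 / 6 : ℝ) * ∑ i, ∑ j, ∑ k,
    g (b i) (b i) * g (b j) (b j) * g (b k) (b k) *
      QuadraticAlgebra.norm (Ψ ![b i, b j, b k])

end Forms

/-- An `SL(3,ℝ)`-structure `(g, J, ω, Ψ)` on a six-dimensional real vector space: a neutral
metric `g`, an anti-orthogonal para-complex structure `J`, the fundamental two-form
`ω = g(·, J ·)`, and a `(3,0)`-form `Ψ` of non-zero length. As `J` is anti-orthogonal, both of its
eigenspaces are isotropic, hence three-dimensional. -/
structure SL3RStructure (V : Type*) [AddCommGroup V] [Module ℝ V] where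
  g : LinearMap.BilinForm ℝ V
  J : V →ₗ[ℝ] V
  ω : V [⋀^Fin 2]→ₗ[ℝ] ℝ
  Ψ : V [⋀^Fin 3]→ₗ[ℝ] ParaComplex
  g_symm : ∀ x y, g x y = g y x
  J_sq : ∀ x, J (J x) = x
  J_anti : ∀ x y, g (J x) (J y) = - g x y
  ω_eq : ∀ x y, ω ![x, y] = g x (J y)
  /-- `Ψ` is of type `(3,0)` with respect to `J`. -/
  Ψ_type : ∀ x y z, Ψ ![J x, y, z] = ParaComplex.e * Ψ ![x, y, z]
  /-- `g` is neutral (in particular non-degenerate), and `Ψ` has non-zero length. -/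
  neutral_length : ∃ b : Module.Basis (Fin 3 ⊕ Fin 3) ℝ V,
    IsNeutralBasis g b ∧ lengthSq g b Ψ ≠ 0

/-- The exterior derivative on left-invariant forms (the Chevalley–Eilenberg differential):
`dα(X₀,…,Xₖ) = ∑_{p<q} (-1)^(p+q) α([X_p,X_q], X₀, …, X̂_p, …, X̂_q, …, Xₖ)`,
where the pairs `p < q` are written as `p = i`, `q = j + 1` with `i ≤ j`. For a one-form this is
`dα(X,Y) = -α([X,Y])`. -/
def lieExtDeriv {L : Type*} [LieRing L] [LieAlgebra ℝ L] {m : ℕ}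
    (α : L [⋀^Fin (m + 1)]→ₗ[ℝ] ℝ) (X : Fin (m + 2) → L) : ℝ :=
  ∑ i : Fin (m + 1), ∑ j : Fin (m + 1),
    if i ≤ j then
      (-1 : ℝ) ^ ((i : ℕ) + (j : ℕ) + 1) *
        α (Fin.cons ⁅X i.castSucc, X j.succ⁆ fun l => X (j.succ.succAbove (i.succAbove l)))
    else 0

/-- A left-invariant form is closed. -/
def IsClosedForm {L : Type*} [LieRing L] [LieAlgebra ℝ L] {m : ℕ}
    (α : L [⋀^Fin (m + 1)]→ₗ[ℝ] ℝ) : Prop :=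
  ∀ X, lieExtDeriv α X = 0

namespace SL3RStructure

/-- The real part `ρ = Re Ψ`. -/
noncomputable def rePart {V : Type*} [AddCommGroup V] [Module ℝ V] (S : SL3RStructure V) :
    V [⋀^Fin 3]→ₗ[ℝ] ℝ :=
  ParaComplex.reLin.compAlternatingMap S.Ψ

/-- The four-form `ω² = ω ∧ ω`. -/
noncomputable def omegaSq {V : Type*} [AddCommGroup V] [Module ℝ V] (S : SL3RStructure V) :
    V [⋀^Fin 4]→ₗ[ℝ] ℝ :=
  formWedge S.ω S.ω

/-- Half-flatness: `dρ = 0` and `d(ω²) = 0`. -/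
def IsHalfFlat {L : Type*} [LieRing L] [LieAlgebra ℝ L] (S : SL3RStructure L) : Prop :=
  IsClosedForm S.rePart ∧ IsClosedForm S.omegaSq

section Sum

variable {L₁ L₂ : Type*} [LieRing L₁] [LieAlgebra ℝ L₁] [LieRing L₂] [LieAlgebra ℝ L₂]

/-- The two summands are mutually orthogonal. -/
def SummandsOrthogonal (S : SL3RStructure (L₁ × L₂)) : Prop :=
  ∀ (x : L₁) (y : L₂), S.g (x, 0) (0, y) = 0

/-- The metric is (positive or negative) definite on each of the two summands. -/
def SummandsDefinite (S : SL3RStructure (L₁ × L₂)) : Prop :=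
  ((∀ x : L₁, x ≠ 0 → 0 < S.g (x, 0) (x, 0)) ∨ (∀ x : L₁, x ≠ 0 → S.g (x, 0) (x, 0) < 0)) ∧
  ((∀ y : L₂, y ≠ 0 → 0 < S.g (0, y) (0, y)) ∨ (∀ y : L₂, y ≠ 0 → S.g (0, y) (0, y) < 0))

/-- There are pseudo-orthonormal bases `e` of `L₁` and `f` of `L₂` (of squares `-σ` and `σ`, for a
sign `σ`) in which
`ω = a e¹² + √(1+a²) e¹f¹ + √(1+a²) e²f² + e³f³ + a f¹²`. -/
def HasNormalForm (S : SL3RStructure (L₁ × L₂)) (a : ℝ) : Prop :=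
  ∃ (σ : ℝ) (e : Module.Basis (Fin 3) ℝ L₁) (f : Module.Basis (Fin 3) ℝ L₂),
    (σ = 1 ∨ σ = -1) ∧
    (∀ i j, S.g (e i, 0) (e j, 0) = if i = j then -σ else 0) ∧
    (∀ i j, S.g (0, f i) (0, f j) = if i = j then σ else 0) ∧
    (∀ i j, S.g (e i, 0) (0, f j) = 0) ∧
    (∀ i j, S.ω ![(e i, 0), (e j, 0)] = !![0, a, 0; -a, 0, 0; 0, 0, 0] i j) ∧
    (∀ i j, S.ω ![(e i, 0), (0, f j)] =
      !![√(1 + a ^ 2), 0, 0; 0, √(1 + a ^ 2), 0; 0, 0, 1] i j) ∧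
    (∀ i j, S.ω ![(0, f i), (0, f j)] = !![0, a, 0; -a, 0, 0; 0, 0, 0] i j)

/-- The para-Hermitian structure is of type I: the normal form is attained with `a = 0`. -/
def IsTypeI (S : SL3RStructure (L₁ × L₂)) : Prop := S.HasNormalForm 0

/-- The para-Hermitian structure is of type II: the normal form is attained with some `a ≠ 0`. -/
def IsTypeII (S : SL3RStructure (L₁ × L₂)) : Prop := ∃ a : ℝ, a ≠ 0 ∧ S.HasNormalForm a

end Sum

end SL3RStructure

section ThreeDim

variable (L : Type*) [LieRing L] [LieAlgebra ℝ L]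

/-- A Lie algebra is unimodular if all `ad X` are trace-free. -/
def IsUnimodularLie : Prop := ∀ x : L, LinearMap.trace ℝ L (LieAlgebra.ad ℝ L x) = 0

/-- `L ≅ su(2)`: `de¹ = e²³`, `de² = e³¹`, `de³ = e¹²`. As `de(X,Y) = -e([X,Y])`, this reads
`[e₂,e₃] = -e₁`, `[e₃,e₁] = -e₂`, `[e₁,e₂] = -e₃`. -/
def IsSu2 : Prop := ∃ b : Module.Basis (Fin 3) ℝ L,
  ⁅b 1, b 2⁆ = - b 0 ∧ ⁅b 2, b 0⁆ = - b 1 ∧ ⁅b 0, b 1⁆ = - b 2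

/-- `L ≅ sl(2,ℝ)`: `de¹ = e²³`, `de² = e³¹`, `de³ = e²¹`. -/
def IsSl2R : Prop := ∃ b : Module.Basis (Fin 3) ℝ L,
  ⁅b 1, b 2⁆ = - b 0 ∧ ⁅b 2, b 0⁆ = - b 1 ∧ ⁅b 0, b 1⁆ = b 2

/-- `L ≅ e(2)`, the Lie algebra of rigid motions of the Euclidean plane:
`de¹ = 0`, `de² = e³¹`, `de³ = e¹²`. -/
def IsE2 : Prop := ∃ b : Module.Basis (Fin 3) ℝ L,
  ⁅b 1, b 2⁆ = 0 ∧ ⁅b 2, b 0⁆ = - b 1 ∧ ⁅b 0, b 1⁆ = - b 2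

/-- `L ≅ e(1,1)`, the Lie algebra of rigid motions of the Minkowskian plane:
`de¹ = 0`, `de² = e³¹`, `de³ = e²¹`. -/
def IsE11 : Prop := ∃ b : Module.Basis (Fin 3) ℝ L,
  ⁅b 1, b 2⁆ = 0 ∧ ⁅b 2, b 0⁆ = - b 1 ∧ ⁅b 0, b 1⁆ = b 2

/-- `L ≅ r₂ ⊕ ℝ`: `de¹ = 0`, `de² = e²¹`, `de³ = 0`. -/
def IsR2PlusR : Prop := ∃ b : Module.Basis (Fin 3) ℝ L,
  ⁅b 1, b 2⁆ = 0 ∧ ⁅b 2, b 0⁆ = 0 ∧ ⁅b 0, b 1⁆ = b 1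

/-- `L ≅ r_{3,μ}`: `de¹ = 0`, `de² = e²¹`, `de³ = μ e³¹`. -/
def IsR3 (μ : ℝ) : Prop := ∃ b : Module.Basis (Fin 3) ℝ L,
  ⁅b 1, b 2⁆ = 0 ∧ ⁅b 0, b 2⁆ = μ • b 2 ∧ ⁅b 0, b 1⁆ = b 1

/-- The ordered pair `(L₁, L₂)` is one of `(e(1,1), e(1,1))`, `(e(2), ℝ ⊕ r₂)`,
`(su(2), r_{3,μ})` with `0 < μ ≤ 1`, `(sl(2,ℝ), r_{3,μ})` with `-1 < μ < 0`. -/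
def InTypeIIList (L₁ L₂ : Type*) [LieRing L₁] [LieAlgebra ℝ L₁] [LieRing L₂] [LieAlgebra ℝ L₂] :
    Prop :=
  (IsE11 L₁ ∧ IsE11 L₂) ∨
  (IsE2 L₁ ∧ IsR2PlusR L₂) ∨
  (IsSu2 L₁ ∧ ∃ μ : ℝ, 0 < μ ∧ μ ≤ 1 ∧ IsR3 L₂ μ) ∨
  (IsSl2R L₁ ∧ ∃ μ : ℝ, -1 < μ ∧ μ < 0 ∧ IsR3 L₂ μ)

end ThreeDim

/-! In bases `e`, `f` realising the normal form, a `(3,0)`-form is determined by its value on `e₁,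
e₂, e₃`, because these vectors together with their images under `J` span everything. Up to
normalisation that value is a pair of real numbers `s, t`, and non-zero length means `s² ≠ t²`. The
model on `ℝ³ × ℝ³` realises every such pair. With `A`, `B` the matrices of structure constants of
the summands, half-flatness becomes the system `HalfFlatEqs`, linear in `A` and `B`, so by
`exists_hasNormalForm_iff` only linear algebra and the recognition of three-dimensional Lie algebras
remain.

For `a = 0` the equations from `ω²` say that both summands are unimodular, and those from `Re Ψ`
reduce to `t B + s A = 0` (`HalfFlatEqs.typeI_iff`). Since `s` and `t` are not both zero, either a
summand is abelian or `A` and `B` are proportional, and rescaling a basis rescales its structure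
constants.

For `a ≠ 0` the matrices split into a 2×2 block and a 1×1 block (`HalfFlatEqs.blocks`). If some
third divergence is non-zero, one summand has a diagonalisable `B` with last entry the trace of its
symmetric block, and the block of the other is a multiple of that block turned by a right angle. The
eigenvalue ratio `μ` then identifies one algebra as `r_{3,μ}` and the other as `de¹ = e²³, de² = μ
e³¹, de³ = (1 + μ) e¹²`, whose type depends on the sign of `μ`. If both third divergences vanish,
the blocks are symmetric and trace-free and vanish together, giving two copies of `e(1,1)` or the
abelian case. Explicit structure constants with `a = ±1` give the converse. -/

/-! ### Explicit formulas for differentials and for the square of a two-form -/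

set_option maxHeartbeats 400000 in
theorem sum_perm_fin_four {M : Type*} [AddCommGroup M] (G : Fin 4 → Fin 4 → Fin 4 → Fin 4 → M) :
    ∑ p : Equiv.Perm (Fin 4), ((Equiv.Perm.sign p : ℤˣ) : ℤ) • G (p 0) (p 1) (p 2) (p 3) =
     G 0 1 2 3 - G 0 1 3 2 - G 0 2 1 3 + G 0 2 3 1 + G 0 3 1 2 - G 0 3 2 1
      - G 1 0 2 3 + G 1 0 3 2 + G 1 2 0 3 - G 1 2 3 0 - G 1 3 0 2 + G 1 3 2 0
      + G 2 0 1 3 - G 2 0 3 1 - G 2 1 0 3 + G 2 1 3 0 + G 2 3 0 1 - G 2 3 1 0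
      - G 3 0 1 2 + G 3 0 2 1 + G 3 1 0 2 - G 3 1 2 0 - G 3 2 0 1 + G 3 2 1 0 := by
  have h (p : Equiv.Perm (Fin 4)) : G (p 0) (p 1) (p 2) (p 3) =
    G (p 0) (p (Fin.succ 0)) (p (Fin.succ (Fin.succ 0))) (p (Fin.succ (Fin.succ (Fin.succ 0)))) := rfl
  simp only [h]
  have h2 : (Finset.univ : Finset (Equiv.Perm (Fin 1))) = {1} := by
    rw [Finset.univ_unique]; rfl
  simp only [Finset.univ_perm_fin_succ, ← Finset.univ_product_univ, Finset.sum_product,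
    Finset.sum_map, Equiv.coe_toEmbedding, Equiv.Perm.decomposeFin_symm_apply_zero,
    Equiv.Perm.decomposeFin_symm_apply_succ, Fin.sum_univ_succ, h2]
  simp
  have s1 : (Equiv.swap (0 : Fin 3) 1) 2 = 2 := by decide
  have s2 : (Equiv.swap (0 : Fin 3) 2) 1 = 1 := by decide
  have t1 : (Equiv.swap (0 : Fin 4) 1) 2 = 2 := by decide
  have t2 : (Equiv.swap (0 : Fin 4) 1) 3 = 3 := by decide
  have t3 : (Equiv.swap (0 : Fin 4) 2) 1 = 1 := by decide
  have t4 : (Equiv.swap (0 : Fin 4) 2) 3 = 3 := by decide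
  have t5 : (Equiv.swap (0 : Fin 4) 3) 1 = 1 := by decide
  have t6 : (Equiv.swap (0 : Fin 4) 3) 2 = 2 := by decide
  simp only [Equiv.swap_apply_right, s1, s2, t1, t2, t3, t4, t5, t6, show (Fin.succ 1 : Fin 4) = 2 from rfl,
    show (Fin.succ 2 : Fin 4) = 3 from rfl]
  abel

section ExtDeriv

variable {L : Type*} [LieRing L] [LieAlgebra ℝ L]

theorem lieExtDeriv_three (α : L [⋀^Fin 3]→ₗ[ℝ] ℝ) (X : Fin 4 → L) :
    lieExtDeriv α X =
      - α ![⁅X 0, X 1⁆, X 2, X 3] + α ![⁅X 0, X 2⁆, X 1, X 3] - α ![⁅X 0, X 3⁆, X 1, X 2]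
      - α ![⁅X 1, X 2⁆, X 0, X 3] + α ![⁅X 1, X 3⁆, X 0, X 2] - α ![⁅X 2, X 3⁆, X 0, X 1] := by
  have h (i j : Fin 3) : (Fin.cons ⁅X i.castSucc, X j.succ⁆
      fun l : Fin 2 => X (j.succ.succAbove (i.succAbove l)) : Fin 3 → L) =
      ![⁅X i.castSucc, X j.succ⁆, X (j.succ.succAbove (i.succAbove 0)),
        X (j.succ.succAbove (i.succAbove 1))] := by
    ext l; fin_cases l <;> rfl
  have e : lieExtDeriv α X = ∑ i : Fin 3, ∑ j : Fin 3, if i ≤ j then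
      (-1 : ℝ) ^ ((i : ℕ) + (j : ℕ) + 1) * α ![⁅X i.castSucc, X j.succ⁆,
        X (j.succ.succAbove (i.succAbove 0)), X (j.succ.succAbove (i.succAbove 1))] else 0 := by
    simp only [← h]; rfl
  rw [e]
  simp only [Fin.sum_univ_three, Fin.isValue, le_refl, if_true, Fin.zero_le,
    show ¬ ((1 : Fin 3) ≤ 0) by decide, show ¬ ((2 : Fin 3) ≤ 0) by decide,
    show ¬ ((2 : Fin 3) ≤ 1) by decide, show ((1 : Fin 3) ≤ 2) by decide, if_false]
  norm_num
  simp only [Fin.succAbove, Fin.lt_def]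
  norm_num
  simp only [show (Fin.succ 2 : Fin 4) = 3 from rfl,
    show (Fin.castSucc 2 : Fin 4) = 2 from rfl]
  ring

theorem lieExtDeriv_four (α : L [⋀^Fin 4]→ₗ[ℝ] ℝ) (X : Fin 5 → L) :
    lieExtDeriv α X =
      - α ![⁅X 0, X 1⁆, X 2, X 3, X 4] + α ![⁅X 0, X 2⁆, X 1, X 3, X 4]
      - α ![⁅X 0, X 3⁆, X 1, X 2, X 4] + α ![⁅X 0, X 4⁆, X 1, X 2, X 3]
      - α ![⁅X 1, X 2⁆, X 0, X 3, X 4] + α ![⁅X 1, X 3⁆, X 0, X 2, X 4]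
      - α ![⁅X 1, X 4⁆, X 0, X 2, X 3] - α ![⁅X 2, X 3⁆, X 0, X 1, X 4]
      + α ![⁅X 2, X 4⁆, X 0, X 1, X 3] - α ![⁅X 3, X 4⁆, X 0, X 1, X 2] := by
  have h (i j : Fin 4) : (Fin.cons ⁅X i.castSucc, X j.succ⁆
      fun l : Fin 3 => X (j.succ.succAbove (i.succAbove l)) : Fin 4 → L) =
      ![⁅X i.castSucc, X j.succ⁆, X (j.succ.succAbove (i.succAbove 0)),
        X (j.succ.succAbove (i.succAbove 1)), X (j.succ.succAbove (i.succAbove 2))] := by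
    ext l; fin_cases l <;> rfl
  have e : lieExtDeriv α X = ∑ i : Fin 4, ∑ j : Fin 4, if i ≤ j then
      (-1 : ℝ) ^ ((i : ℕ) + (j : ℕ) + 1) * α ![⁅X i.castSucc, X j.succ⁆,
        X (j.succ.succAbove (i.succAbove 0)), X (j.succ.succAbove (i.succAbove 1)),
        X (j.succ.succAbove (i.succAbove 2))] else 0 := by
    simp only [← h]; rfl
  rw [e]
  simp only [Fin.sum_univ_four, Fin.isValue, le_refl, if_true, Fin.zero_le,
    show ¬ ((1 : Fin 4) ≤ 0) by decide, show ¬ ((2 : Fin 4) ≤ 0) by decide,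
    show ¬ ((3 : Fin 4) ≤ 0) by decide, show ¬ ((3 : Fin 4) ≤ 1) by decide,
    show ¬ ((3 : Fin 4) ≤ 2) by decide, show ((1 : Fin 4) ≤ 3) by decide,
    show ((2 : Fin 4) ≤ 3) by decide,
    show ¬ ((2 : Fin 4) ≤ 1) by decide, show ((1 : Fin 4) ≤ 2) by decide, if_false]
  norm_num
  simp only [Fin.succAbove, Fin.lt_def]
  norm_num
  simp only [
    show (Fin.succ 2 : Fin 5) = 3 from rfl, show (Fin.castSucc 2 : Fin 5) = 2 from rfl,
    show (Fin.succ 3 : Fin 5) = 4 from rfl,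
    show (Fin.castSucc 3 : Fin 5) = 3 from rfl, show ((Fin.succ 2).succ : Fin 5) = 4 from rfl,
    show ((Fin.castSucc 2).succ : Fin 5) = 3 from rfl,
    show ((Fin.castSucc 2).castSucc : Fin 5) = 2 from rfl]
  ring

/-- The alternatisation of `α ⊗ α` is `2! · 2!` times the shuffle product. In its 24 signed terms
each of the three products occurs eight times, which leaves the factor 2. -/
theorem formWedge_two_two {V : Type*} [AddCommGroup V] [Module ℝ V]
    (α : V [⋀^Fin 2]→ₗ[ℝ] ℝ) (x y z w : V) :
    formWedge α α ![x, y, z, w] =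
      2 * (α ![x, y] * α ![z, w] - α ![x, z] * α ![y, w] + α ![x, w] * α ![y, z]) := by
  have hs : ∀ x y, α ![y, x] = - α ![x, y] := fun x y => by
    have := α.map_swap ![x, y] (i := 0) (j := 1) (by decide)
    rw [← this]; congr 1; ext i; fin_cases i <;> rfl
  set v : Fin 4 → V := ![x, y, z, w] with hv
  have key := congrArg (fun A => LinearMap.mul' ℝ ℝ (A (v ∘ finSumFinEquiv)))
    (MultilinearMap.domCoprod_alternization_eq α α)
  simp only [MultilinearMap.alternatization_apply] at key
  -- The sum over permutations of `Fin 2 ⊕ Fin 2` becomes one over permutations of `Fin 4`.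
  rw [← Equiv.sum_comp (finSumFinEquiv (m := 2) (n := 2)).symm.permCongr] at key
  have e1 : LinearMap.mul' ℝ ℝ ((α.domCoprod α) (v ∘ finSumFinEquiv)) = formWedge α α v := rfl
  have hG : ∀ p : Equiv.Perm (Fin (2 + 2)), (LinearMap.mul' ℝ ℝ) (((MultilinearMap.domDomCongr
        ((finSumFinEquiv (m := 2) (n := 2)).symm.permCongr p))
        ((α : MultilinearMap ℝ (fun _ => V) ℝ).domCoprod (α : MultilinearMap ℝ (fun _ => V) ℝ)))
          (v ∘ finSumFinEquiv)) =
      (fun a b c d : Fin 4 => α ![v a, v b] * α ![v c, v d]) (p 0) (p 1) (p 2) (p 3) := by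
    intro σ
    simp only [MultilinearMap.domDomCongr_apply, MultilinearMap.domCoprod_apply,
      LinearMap.mul'_apply, AlternatingMap.coe_multilinearMap]
    congr 2 <;> ext i <;> fin_cases i <;> simp [Equiv.permCongr_apply] <;> rfl
  simp only [map_sum, Units.smul_def, map_zsmul, hG, Equiv.Perm.sign_permCongr] at key
  rw [sum_perm_fin_four (fun a b c d : Fin 4 => α ![v a, v b] * α ![v c, v d])] at key
  simp only [AlternatingMap.smul_apply, map_nsmul, Fintype.card_fin, e1] at key
  simp only [hv, Matrix.cons_val] at key
  rw [hs x y, hs x z, hs x w, hs y z, hs y w, hs z w] at key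
  simp [Nat.factorial] at key
  linarith

end ExtDeriv

/-! ### Multilinearity and antisymmetry in vector notation -/

section VecForms

variable {V : Type*} [AddCommGroup V] [Module ℝ V]
variable {N : Type*} [AddCommGroup N] [Module ℝ N]

theorem alt₃_add₁ (α : V [⋀^Fin 3]→ₗ[ℝ] N) (x x' y z : V) :
    α ![x + x', y, z] = α ![x, y, z] + α ![x', y, z] := by
  simpa using α.map_vecCons_add ![y, z] x x'

theorem alt₃_smul₁ (α : V [⋀^Fin 3]→ₗ[ℝ] N) (c : ℝ) (x y z : V) :
    α ![c • x, y, z] = c • α ![x, y, z] := by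
  simpa using α.map_vecCons_smul ![y, z] c x

theorem alt₃_swap₁ (α : V [⋀^Fin 3]→ₗ[ℝ] N) (x y z : V) :
    α ![y, x, z] = - α ![x, y, z] := by
  rw [← α.map_swap ![x, y, z] (i := 0) (j := 1) (by decide)]
  congr 1; ext i; fin_cases i <;> rfl

theorem alt₃_swap₂ (α : V [⋀^Fin 3]→ₗ[ℝ] N) (x y z : V) :
    α ![x, z, y] = - α ![x, y, z] := by
  rw [← α.map_swap ![x, y, z] (i := 1) (j := 2) (by decide)]
  congr 1; ext i; fin_cases i <;> rfl

theorem alt₃_add₂ (α : V [⋀^Fin 3]→ₗ[ℝ] N) (x y y' z : V) :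
    α ![x, y + y', z] = α ![x, y, z] + α ![x, y', z] := by
  rw [alt₃_swap₁, alt₃_add₁, alt₃_swap₁, alt₃_swap₁ _ x y' z, neg_add, neg_neg, neg_neg]

theorem alt₃_smul₂ (α : V [⋀^Fin 3]→ₗ[ℝ] N) (c : ℝ) (x y z : V) :
    α ![x, c • y, z] = c • α ![x, y, z] := by
  rw [alt₃_swap₁, alt₃_smul₁, alt₃_swap₁, smul_neg, neg_neg]

theorem alt₃_add₃ (α : V [⋀^Fin 3]→ₗ[ℝ] N) (x y z z' : V) :
    α ![x, y, z + z'] = α ![x, y, z] + α ![x, y, z'] := by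
  rw [alt₃_swap₂, alt₃_add₂, alt₃_swap₂, alt₃_swap₂ _ x y z', neg_add, neg_neg, neg_neg]

theorem alt₃_smul₃ (α : V [⋀^Fin 3]→ₗ[ℝ] N) (c : ℝ) (x y z : V) :
    α ![x, y, c • z] = c • α ![x, y, z] := by
  rw [alt₃_swap₂, alt₃_smul₂, alt₃_swap₂, smul_neg, neg_neg]

theorem alt₃_self₁ (α : V [⋀^Fin 3]→ₗ[ℝ] N) (x z : V) : α ![x, x, z] = 0 :=
  α.map_eq_zero_of_eq _ (i := 0) (j := 1) rfl (by decide)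

theorem alt₃_self₂ (α : V [⋀^Fin 3]→ₗ[ℝ] N) (x z : V) : α ![z, x, x] = 0 :=
  α.map_eq_zero_of_eq _ (i := 1) (j := 2) rfl (by decide)

theorem alt₃_self₃ (α : V [⋀^Fin 3]→ₗ[ℝ] N) (x z : V) : α ![x, z, x] = 0 :=
  α.map_eq_zero_of_eq _ (i := 0) (j := 2) rfl (by decide)

theorem alt₄_add₁ (α : V [⋀^Fin 4]→ₗ[ℝ] N) (x x' y z w : V) :
    α ![x + x', y, z, w] = α ![x, y, z, w] + α ![x', y, z, w] := by
  simpa using α.map_vecCons_add ![y, z, w] x x'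

theorem alt₄_smul₁ (α : V [⋀^Fin 4]→ₗ[ℝ] N) (c : ℝ) (x y z w : V) :
    α ![c • x, y, z, w] = c • α ![x, y, z, w] := by
  simpa using α.map_vecCons_smul ![y, z, w] c x

theorem alt₄_swap₁ (α : V [⋀^Fin 4]→ₗ[ℝ] N) (x y z w : V) :
    α ![y, x, z, w] = - α ![x, y, z, w] := by
  rw [← α.map_swap ![x, y, z, w] (i := 0) (j := 1) (by decide)]
  congr 1; ext i; fin_cases i <;> rfl

theorem alt₄_swap₂ (α : V [⋀^Fin 4]→ₗ[ℝ] N) (x y z w : V) :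
    α ![x, z, y, w] = - α ![x, y, z, w] := by
  rw [← α.map_swap ![x, y, z, w] (i := 1) (j := 2) (by decide)]
  congr 1; ext i; fin_cases i <;> rfl

theorem alt₄_swap₃ (α : V [⋀^Fin 4]→ₗ[ℝ] N) (x y z w : V) :
    α ![x, y, w, z] = - α ![x, y, z, w] := by
  rw [← α.map_swap ![x, y, z, w] (i := 2) (j := 3) (by decide)]
  congr 1; ext i; fin_cases i <;> rfl

theorem alt₄_add₂ (α : V [⋀^Fin 4]→ₗ[ℝ] N) (x y y' z w : V) :
    α ![x, y + y', z, w] = α ![x, y, z, w] + α ![x, y', z, w] := by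
  rw [alt₄_swap₁, alt₄_add₁, alt₄_swap₁, alt₄_swap₁ _ x y', neg_add, neg_neg, neg_neg]

theorem alt₄_smul₂ (α : V [⋀^Fin 4]→ₗ[ℝ] N) (c : ℝ) (x y z w : V) :
    α ![x, c • y, z, w] = c • α ![x, y, z, w] := by
  rw [alt₄_swap₁, alt₄_smul₁, alt₄_swap₁, smul_neg, neg_neg]

theorem alt₄_add₃ (α : V [⋀^Fin 4]→ₗ[ℝ] N) (x y z z' w : V) :
    α ![x, y, z + z', w] = α ![x, y, z, w] + α ![x, y, z', w] := by
  rw [alt₄_swap₂, alt₄_add₂, alt₄_swap₂, alt₄_swap₂ _ x y z', neg_add, neg_neg, neg_neg]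

theorem alt₄_smul₃ (α : V [⋀^Fin 4]→ₗ[ℝ] N) (c : ℝ) (x y z w : V) :
    α ![x, y, c • z, w] = c • α ![x, y, z, w] := by
  rw [alt₄_swap₂, alt₄_smul₂, alt₄_swap₂, smul_neg, neg_neg]

theorem alt₄_add₄ (α : V [⋀^Fin 4]→ₗ[ℝ] N) (x y z w w' : V) :
    α ![x, y, z, w + w'] = α ![x, y, z, w] + α ![x, y, z, w'] := by
  rw [alt₄_swap₃, alt₄_add₃, alt₄_swap₃, alt₄_swap₃ _ x y z w', neg_add, neg_neg, neg_neg]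

theorem alt₄_smul₄ (α : V [⋀^Fin 4]→ₗ[ℝ] N) (c : ℝ) (x y z w : V) :
    α ![x, y, z, c • w] = c • α ![x, y, z, w] := by
  rw [alt₄_swap₃, alt₄_smul₃, alt₄_swap₃, smul_neg, neg_neg]

end VecForms

/-! ### The differential of an alternating form is alternating -/

section ExtDerivAlternating

variable {L : Type*} [LieRing L] [LieAlgebra ℝ L]

/-- The differential of a three-form, as a four-form. -/
def extDerivThree (α : L [⋀^Fin 3]→ₗ[ℝ] ℝ) : L [⋀^Fin 4]→ₗ[ℝ] ℝ where
  toFun := lieExtDeriv α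
  map_update_add' := by
    intro inst X i v v'
    obtain rfl : inst = instDecidableEqFin _ := Subsingleton.elim _ _
    simp only [lieExtDeriv_three]
    fin_cases i <;>
    simp [Function.update, alt₃_add₁, alt₃_add₂, alt₃_add₃, -neg_add_rev] <;> ring
  map_update_smul' := by
    intro inst X i c v
    obtain rfl : inst = instDecidableEqFin _ := Subsingleton.elim _ _
    simp only [lieExtDeriv_three]
    fin_cases i <;>
    simp [Function.update, alt₃_smul₁, alt₃_smul₂, alt₃_smul₃, -neg_add_rev] <;> ring
  map_eq_zero_of_eq' X i j h hij := by
    -- When two arguments coincide, a term vanishes if both are inside the bracket or both outside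
    -- it; the remaining terms cancel in pairs.
    have h1 : ∀ p q r s : L, α ![⁅q, p⁆, r, s] = - α ![⁅p, q⁆, r, s] := fun p q r s => by
      rw [← lie_skew, ← neg_one_smul ℝ, alt₃_smul₁]; simp
    have h2 : ∀ p q r s : L, α ![⁅p, q⁆, s, r] = - α ![⁅p, q⁆, r, s] := fun p q r s =>
      alt₃_swap₂ ..
    have h3 : ∀ p r s : L, α ![⁅p, p⁆, r, s] = 0 := fun p r s => by
      rw [lie_self]; exact α.map_coord_zero 0 (m := _) rfl
    have h4 : ∀ p r : L, α ![p, r, r] = 0 := fun p r => alt₃_self₂ ..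
    simp only [lieExtDeriv_three]
    fin_cases i <;> fin_cases j <;> simp at h hij ⊢ <;> simp only [h, h3, h4] <;> grind

/-- The differential of a four-form, as a five-form. -/
def extDerivFour (α : L [⋀^Fin 4]→ₗ[ℝ] ℝ) : L [⋀^Fin 5]→ₗ[ℝ] ℝ where
  toFun := lieExtDeriv α
  map_update_add' := by
    intro inst X i v v'
    obtain rfl : inst = instDecidableEqFin _ := Subsingleton.elim _ _
    simp only [lieExtDeriv_four]
    fin_cases i <;>
    simp [Function.update, alt₄_add₁, alt₄_add₂, alt₄_add₃, alt₄_add₄, -neg_add_rev] <;> ring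
  map_update_smul' := by
    intro inst X i c v
    obtain rfl : inst = instDecidableEqFin _ := Subsingleton.elim _ _
    simp only [lieExtDeriv_four]
    fin_cases i <;>
    simp [Function.update, alt₄_smul₁, alt₄_smul₂, alt₄_smul₃, alt₄_smul₄, -neg_add_rev] <;> ring
  map_eq_zero_of_eq' X i j h hij := by
    have h1 : ∀ p q r s t : L, α ![⁅q, p⁆, r, s, t] = - α ![⁅p, q⁆, r, s, t] :=
      fun p q r s t => by rw [← lie_skew, ← neg_one_smul ℝ, alt₄_smul₁]; simp
    have h2 : ∀ p q r s t : L, α ![⁅p, q⁆, s, r, t] = - α ![⁅p, q⁆, r, s, t] :=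
      fun p q r s t => alt₄_swap₂ ..
    have h2' : ∀ p q r s t : L, α ![⁅p, q⁆, r, t, s] = - α ![⁅p, q⁆, r, s, t] :=
      fun p q r s t => alt₄_swap₃ ..
    have h3 : ∀ p r s t : L, α ![⁅p, p⁆, r, s, t] = 0 := fun p r s t => by
      rw [lie_self]; exact α.map_coord_zero 0 (m := _) rfl
    have h4 : ∀ p r s : L, α ![p, r, r, s] = 0 := fun p r s =>
      α.map_eq_zero_of_eq _ (i := 1) (j := 2) rfl (by decide)
    have h5 : ∀ p r s : L, α ![p, r, s, r] = 0 := fun p r s =>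
      α.map_eq_zero_of_eq _ (i := 1) (j := 3) rfl (by decide)
    have h6 : ∀ p r s : L, α ![p, s, r, r] = 0 := fun p r s =>
      α.map_eq_zero_of_eq _ (i := 2) (j := 3) rfl (by decide)
    simp only [lieExtDeriv_four]
    fin_cases i <;> fin_cases j <;> simp at h hij ⊢ <;>
    simp only [h, h3, h4, h5, h6] <;> grind

end ExtDerivAlternating

/-! ### Testing alternating forms on increasing index tuples -/

section StrictMonoExt

/-- Sorting an injective index tuple makes it increasing and changes the value only by a sign. -/
theorem alternatingMap_eq_zero_of_strictMono {V N : Type*} [AddCommGroup V] [Module ℝ V]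
    [AddCommGroup N] [Module ℝ N] {m n : ℕ} (b : Module.Basis (Fin n) ℝ V)
    (α : V [⋀^Fin m]→ₗ[ℝ] N) (h : ∀ v : Fin m → Fin n, StrictMono v → α (fun i => b (v i)) = 0) :
    α = 0 := by
  refine b.ext_alternating fun v hv => ?_
  have hs : StrictMono (v ∘ Tuple.sort v) :=
    (Tuple.monotone_sort v).strictMono_of_injective (hv.comp (Tuple.sort v).injective)
  have h1 := h _ hs
  have h2 := α.map_perm (fun i => b (v i)) (Tuple.sort v)
  simp only [Function.comp_def] at h1 h2
  rw [h1] at h2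
  simpa using ((smul_eq_zero_iff_eq _).mp h2.symm)

theorem strictMono_fin_four_six {P : Fin 6 → Fin 6 → Fin 6 → Fin 6 → Prop}
    (h : P 0 1 2 3 ∧ P 0 1 2 4 ∧ P 0 1 2 5 ∧ P 0 1 3 4 ∧ P 0 1 3 5 ∧ P 0 1 4 5 ∧ P 0 2 3 4 ∧
      P 0 2 3 5 ∧ P 0 2 4 5 ∧ P 0 3 4 5 ∧ P 1 2 3 4 ∧ P 1 2 3 5 ∧ P 1 2 4 5 ∧ P 1 3 4 5 ∧
      P 2 3 4 5) (v : Fin 4 → Fin 6) (hv : StrictMono v) : P (v 0) (v 1) (v 2) (v 3) := by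
  have h01 : v 0 < v 1 := hv (by decide)
  have h12 : v 1 < v 2 := hv (by decide)
  have h23 : v 2 < v 3 := hv (by decide)
  generalize v 0 = i at *
  generalize v 1 = j at *
  generalize v 2 = k at *
  generalize v 3 = l at *
  clear hv
  fin_cases i <;> fin_cases j <;> (try (exfalso; revert h01; decide)) <;>
  fin_cases k <;> (try (exfalso; revert h12; decide)) <;>
  fin_cases l <;> (try (exfalso; revert h23; decide)) <;> simp_all

theorem strictMono_fin_five_six {P : Fin 6 → Fin 6 → Fin 6 → Fin 6 → Fin 6 → Prop}
    (h : P 0 1 2 3 4 ∧ P 0 1 2 3 5 ∧ P 0 1 2 4 5 ∧ P 0 1 3 4 5 ∧ P 0 2 3 4 5 ∧ P 1 2 3 4 5)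
    (v : Fin 5 → Fin 6) (hv : StrictMono v) : P (v 0) (v 1) (v 2) (v 3) (v 4) := by
  have h01 : v 0 < v 1 := hv (by decide)
  have h12 : v 1 < v 2 := hv (by decide)
  have h23 : v 2 < v 3 := hv (by decide)
  have h34 : v 3 < v 4 := hv (by decide)
  generalize v 0 = i at *
  generalize v 1 = j at *
  generalize v 2 = k at *
  generalize v 3 = l at *
  generalize v 4 = m at *
  clear hv
  fin_cases i <;> fin_cases j <;> (try (exfalso; revert h01; decide)) <;>
  fin_cases k <;> (try (exfalso; revert h12; decide)) <;>
  fin_cases l <;> (try (exfalso; revert h23; decide)) <;>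
  fin_cases m <;> (try (exfalso; revert h34; decide)) <;> simp_all

theorem forall_strictMono_fin_four_six {P : Fin 6 → Fin 6 → Fin 6 → Fin 6 → Prop} :
    (∀ v : Fin 4 → Fin 6, StrictMono v → P (v 0) (v 1) (v 2) (v 3)) ↔
      (P 0 1 2 3 ∧ P 0 1 2 4 ∧ P 0 1 2 5 ∧ P 0 1 3 4 ∧ P 0 1 3 5 ∧ P 0 1 4 5 ∧ P 0 2 3 4 ∧
      P 0 2 3 5 ∧ P 0 2 4 5 ∧ P 0 3 4 5 ∧ P 1 2 3 4 ∧ P 1 2 3 5 ∧ P 1 2 4 5 ∧ P 1 3 4 5 ∧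
      P 2 3 4 5) := by
  refine ⟨fun H => ?_, strictMono_fin_four_six⟩
  have g : ∀ a b c d : Fin 6, a < b → b < c → c < d → P a b c d := fun a b c d h1 h2 h3 =>
    H ![a, b, c, d] (Fin.strictMono_iff_lt_succ.mpr fun i => by fin_cases i <;> assumption)
  refine ⟨?_, ?_, ?_, ?_, ?_, ?_, ?_, ?_, ?_, ?_, ?_, ?_, ?_, ?_, ?_⟩ <;>
    exact g _ _ _ _ (by decide) (by decide) (by decide)

theorem forall_strictMono_fin_five_six {P : Fin 6 → Fin 6 → Fin 6 → Fin 6 → Fin 6 → Prop} :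
    (∀ v : Fin 5 → Fin 6, StrictMono v → P (v 0) (v 1) (v 2) (v 3) (v 4)) ↔
      (P 0 1 2 3 4 ∧ P 0 1 2 3 5 ∧ P 0 1 2 4 5 ∧ P 0 1 3 4 5 ∧ P 0 2 3 4 5 ∧ P 1 2 3 4 5) := by
  refine ⟨fun H => ?_, strictMono_fin_five_six⟩
  have g : ∀ a b c d f : Fin 6, a < b → b < c → c < d → d < f → P a b c d f :=
    fun a b c d f h1 h2 h3 h4 => H ![a, b, c, d, f]
      (Fin.strictMono_iff_lt_succ.mpr fun i => by fin_cases i <;> assumption)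
  refine ⟨?_, ?_, ?_, ?_, ?_, ?_⟩ <;>
    exact g _ _ _ _ _ (by decide) (by decide) (by decide) (by decide)

end StrictMonoExt

/-! ### Structure constants and bases of a direct sum -/

section Structure

theorem vec_eq_four {M : Type*} (w : Fin 4 → M) : w = ![w 0, w 1, w 2, w 3] := by
  ext i; fin_cases i <;> rfl

theorem vec_eq_five {M : Type*} (w : Fin 5 → M) : w = ![w 0, w 1, w 2, w 3, w 4] := by
  ext i; fin_cases i <;> rfl

/-- `A` is the matrix of structure constants of a three-dimensional Lie algebra in the basis `e`:
`de^i = A i 0 e²³ + A i 1 e³¹ + A i 2 e¹²`. -/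
def HasStructure {L : Type*} [LieRing L] [LieAlgebra ℝ L] (e : Module.Basis (Fin 3) ℝ L)
    (A : Fin 3 → Fin 3 → ℝ) : Prop :=
  ⁅e 1, e 2⁆ = -(A 0 0 • e 0 + A 1 0 • e 1 + A 2 0 • e 2) ∧
  ⁅e 2, e 0⁆ = -(A 0 1 • e 0 + A 1 1 • e 1 + A 2 1 • e 2) ∧
  ⁅e 0, e 1⁆ = -(A 0 2 • e 0 + A 1 2 • e 1 + A 2 2 • e 2)

variable {L₁ L₂ : Type*} [LieRing L₁] [LieAlgebra ℝ L₁] [LieRing L₂] [LieAlgebra ℝ L₂]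

/-- The basis `e₁, e₂, e₃, f₁, f₂, f₃` of a direct sum. -/
noncomputable def sumBasis (e : Module.Basis (Fin 3) ℝ L₁) (f : Module.Basis (Fin 3) ℝ L₂) :
    Module.Basis (Fin 6) ℝ (L₁ × L₂) :=
  (e.prod f).reindex finSumFinEquiv

variable (e : Module.Basis (Fin 3) ℝ L₁) (f : Module.Basis (Fin 3) ℝ L₂)

theorem sumBasis_inl (i : Fin 3) : sumBasis e f (Fin.castAdd 3 i) = (e i, 0) := by
  have : (finSumFinEquiv (m := 3) (n := 3)).symm (Fin.castAdd 3 i) = Sum.inl i :=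
    finSumFinEquiv_symm_apply_castAdd i
  rw [sumBasis, Module.Basis.reindex_apply, this]
  simp [Module.Basis.prod_apply]

theorem sumBasis_inr (i : Fin 3) : sumBasis e f (Fin.natAdd 3 i) = (0, f i) := by
  have : (finSumFinEquiv (m := 3) (n := 3)).symm (Fin.natAdd 3 i) = Sum.inr i :=
    finSumFinEquiv_symm_apply_natAdd i
  rw [sumBasis, Module.Basis.reindex_apply, this]
  simp [Module.Basis.prod_apply]

theorem sumBasis_apply : sumBasis e f 0 = (e 0, 0) ∧ sumBasis e f 1 = (e 1, 0) ∧
    sumBasis e f 2 = (e 2, 0) ∧ sumBasis e f 3 = (0, f 0) ∧ sumBasis e f 4 = (0, f 1) ∧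
    sumBasis e f 5 = (0, f 2) :=
  ⟨sumBasis_inl e f 0, sumBasis_inl e f 1, sumBasis_inl e f 2, sumBasis_inr e f 0,
    sumBasis_inr e f 1, sumBasis_inr e f 2⟩

theorem isClosedForm_three_iff (ρ : (L₁ × L₂) [⋀^Fin 3]→ₗ[ℝ] ℝ) :
    IsClosedForm ρ ↔ ∀ v : Fin 4 → Fin 6, StrictMono v →
      lieExtDeriv ρ ![sumBasis e f (v 0), sumBasis e f (v 1), sumBasis e f (v 2),
        sumBasis e f (v 3)] = 0 := by
  refine ⟨fun h v _ => h _, fun h => ?_⟩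
  have h0 : extDerivThree ρ = 0 :=
    alternatingMap_eq_zero_of_strictMono (sumBasis e f) _ fun v hv => by
      rw [← h v hv, vec_eq_four fun i => sumBasis e f (v i)]; rfl
  exact fun X => congrArg (fun A => A X) h0

theorem isClosedForm_four_iff (β : (L₁ × L₂) [⋀^Fin 4]→ₗ[ℝ] ℝ) :
    IsClosedForm β ↔ ∀ v : Fin 5 → Fin 6, StrictMono v →
      lieExtDeriv β ![sumBasis e f (v 0), sumBasis e f (v 1), sumBasis e f (v 2),
        sumBasis e f (v 3), sumBasis e f (v 4)] = 0 := by
  refine ⟨fun h v _ => h _, fun h => ?_⟩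
  have h0 : extDerivFour β = 0 :=
    alternatingMap_eq_zero_of_strictMono (sumBasis e f) _ fun v hv => by
      rw [← h v hv, vec_eq_five fun i => sumBasis e f (v i)]; rfl
  exact fun X => congrArg (fun A => A X) h0

variable {e f}

theorem HasStructure.prod_left {A : Fin 3 → Fin 3 → ℝ} (hA : HasStructure e A) :
    (⁅((e 1, 0) : L₁ × L₂), ((e 2, 0) : L₁ × L₂)⁆ =
      (-A 0 0) • (e 0, 0) + (-A 1 0) • (e 1, 0) + (-A 2 0) • (e 2, 0)) ∧
    (⁅((e 0, 0) : L₁ × L₂), ((e 2, 0) : L₁ × L₂)⁆ =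
      (A 0 1) • (e 0, 0) + (A 1 1) • (e 1, 0) + (A 2 1) • (e 2, 0)) ∧
    (⁅((e 0, 0) : L₁ × L₂), ((e 1, 0) : L₁ × L₂)⁆ =
      (-A 0 2) • (e 0, 0) + (-A 1 2) • (e 1, 0) + (-A 2 2) • (e 2, 0)) := by
  obtain ⟨h1, h2, h3⟩ := hA
  rw [← lie_skew, neg_eq_iff_eq_neg, neg_neg] at h2
  refine ⟨?_, ?_, ?_⟩ <;> ext <;> simp [h1, h2, h3] <;> abel

theorem HasStructure.prod_right {B : Fin 3 → Fin 3 → ℝ} (hB : HasStructure f B) :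
    (⁅((0, f 1) : L₁ × L₂), ((0, f 2) : L₁ × L₂)⁆ =
      (-B 0 0) • (0, f 0) + (-B 1 0) • (0, f 1) + (-B 2 0) • (0, f 2)) ∧
    (⁅((0, f 0) : L₁ × L₂), ((0, f 2) : L₁ × L₂)⁆ =
      (B 0 1) • (0, f 0) + (B 1 1) • (0, f 1) + (B 2 1) • (0, f 2)) ∧
    (⁅((0, f 0) : L₁ × L₂), ((0, f 1) : L₁ × L₂)⁆ =
      (-B 0 2) • (0, f 0) + (-B 1 2) • (0, f 1) + (-B 2 2) • (0, f 2)) := by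
  obtain ⟨h1, h2, h3⟩ := hB
  rw [← lie_skew, neg_eq_iff_eq_neg, neg_neg] at h2
  refine ⟨?_, ?_, ?_⟩ <;> ext <;> simp [h1, h2, h3] <;> abel

omit [LieAlgebra ℝ L₁] [LieAlgebra ℝ L₂] in
theorem prod_lie_left_right (x : L₁) (y : L₂) : ⁅((x, 0) : L₁ × L₂), ((0, y) : L₁ × L₂)⁆ = 0 := by
  ext <;> simp

end Structure

/-! ### Closedness of three- and four-forms in structure constants -/

section ClosedForms

variable {L₁ L₂ : Type*} [LieRing L₁] [LieAlgebra ℝ L₁] [LieRing L₂] [LieAlgebra ℝ L₂]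

/-- The components `p` of bidegree `(2,1)` and `q` of bidegree `(1,2)` of a three-form:
`p i j` is the coefficient of `Eʲ ∧ fⁱ` and `q k l` that of `eˡ ∧ Fᵏ`, where
`E¹ = e²³` and so on cyclically. -/
structure ThreeFormTable (e : Module.Basis (Fin 3) ℝ L₁) (f : Module.Basis (Fin 3) ℝ L₂)
    (ρ : (L₁ × L₂) [⋀^Fin 3]→ₗ[ℝ] ℝ) (p q : Fin 3 → Fin 3 → ℝ) : Prop where
  p0 : ∀ i, ρ ![(e 1, 0), (e 2, 0), (0, f i)] = p i 0
  p1 : ∀ i, ρ ![(e 0, 0), (e 2, 0), (0, f i)] = - p i 1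
  p2 : ∀ i, ρ ![(e 0, 0), (e 1, 0), (0, f i)] = p i 2
  q0 : ∀ i, ρ ![(e i, 0), (0, f 1), (0, f 2)] = q 0 i
  q1 : ∀ i, ρ ![(e i, 0), (0, f 0), (0, f 2)] = - q 1 i
  q2 : ∀ i, ρ ![(e i, 0), (0, f 0), (0, f 1)] = q 2 i

/-- The components of a four-form of bidegrees `(2,2)`, `(3,1)` and `(1,3)`: the coefficients
`m j k` of `Eʲ ∧ Fᵏ`, `n k` of `e¹²³ ∧ fᵏ` and `o l` of `eˡ ∧ f¹²³`. -/
structure FourFormTable (e : Module.Basis (Fin 3) ℝ L₁) (f : Module.Basis (Fin 3) ℝ L₂)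
    (β : (L₁ × L₂) [⋀^Fin 4]→ₗ[ℝ] ℝ) (m : Fin 3 → Fin 3 → ℝ) (n o : Fin 3 → ℝ) : Prop where
  m00 : β ![(e 1, 0), (e 2, 0), (0, f 1), (0, f 2)] = m 0 0
  m01 : β ![(e 1, 0), (e 2, 0), (0, f 0), (0, f 2)] = - m 0 1
  m02 : β ![(e 1, 0), (e 2, 0), (0, f 0), (0, f 1)] = m 0 2
  m10 : β ![(e 0, 0), (e 2, 0), (0, f 1), (0, f 2)] = - m 1 0
  m11 : β ![(e 0, 0), (e 2, 0), (0, f 0), (0, f 2)] = m 1 1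
  m12 : β ![(e 0, 0), (e 2, 0), (0, f 0), (0, f 1)] = - m 1 2
  m20 : β ![(e 0, 0), (e 1, 0), (0, f 1), (0, f 2)] = m 2 0
  m21 : β ![(e 0, 0), (e 1, 0), (0, f 0), (0, f 2)] = - m 2 1
  m22 : β ![(e 0, 0), (e 1, 0), (0, f 0), (0, f 1)] = m 2 2
  n : ∀ k, β ![(e 0, 0), (e 1, 0), (e 2, 0), (0, f k)] = n k
  o : ∀ l, β ![(e l, 0), (0, f 0), (0, f 1), (0, f 2)] = o l

/-- The antisymmetric part of the structure matrix: `d(e²³) = divergence A 0 • e¹²³` and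
cyclically. -/
def divergence (A : Fin 3 → Fin 3 → ℝ) : Fin 3 → ℝ :=
  ![A 1 2 - A 2 1, A 2 0 - A 0 2, A 0 1 - A 1 0]

variable {e : Module.Basis (Fin 3) ℝ L₁} {f : Module.Basis (Fin 3) ℝ L₂}
  {A B : Fin 3 → Fin 3 → ℝ}

/-- The three groups of equations are the components of `dρ` of bidegree `(3,1)`, `(1,3)` and
`(2,2)`. The `e¹²³` and `f¹²³` parts of `ρ` are always closed, so the table omits them. -/
theorem isClosedForm_iff_of_threeFormTable (hA : HasStructure e A) (hB : HasStructure f B)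
    {ρ : (L₁ × L₂) [⋀^Fin 3]→ₗ[ℝ] ℝ} {p q : Fin 3 → Fin 3 → ℝ} (h : ThreeFormTable e f ρ p q) :
    IsClosedForm ρ ↔
      (∀ k, ∑ j, p k j * divergence A j = 0) ∧ (∀ l, ∑ k, q k l * divergence B k = 0) ∧
      (∀ j k, ∑ i, (p i j * B i k + q k i * A i j) = 0) := by
  have sw1 : ∀ (y : L₂) (x : L₁) z, ρ ![(0, y), (x, 0), z] = - ρ ![(x, 0), (0, y), z] :=
    fun y x z => alt₃_swap₁ ..
  have sw2 : ∀ (x : L₁) (y : L₂) (z : L₁),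
      ρ ![(x, 0), (0, y), (z, 0)] = - ρ ![(x, 0), (z, 0), (0, y)] := fun x y z => alt₃_swap₂ ..
  have z1 : ∀ y z, ρ ![0, y, z] = 0 := fun y z => ρ.map_coord_zero 0 (m := _) rfl
  have e10 : ∀ z, ρ ![(e 1, 0), (e 0, 0), z] = - ρ ![(e 0, 0), (e 1, 0), z] :=
    fun z => alt₃_swap₁ ..
  have e20 : ∀ z, ρ ![(e 2, 0), (e 0, 0), z] = - ρ ![(e 0, 0), (e 2, 0), z] :=
    fun z => alt₃_swap₁ ..
  have e21 : ∀ z, ρ ![(e 2, 0), (e 1, 0), z] = - ρ ![(e 1, 0), (e 2, 0), z] :=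
    fun z => alt₃_swap₁ ..
  have f10 : ∀ z, ρ ![z, (0, f 1), (0, f 0)] = - ρ ![z, (0, f 0), (0, f 1)] :=
    fun z => alt₃_swap₂ ..
  have f20 : ∀ z, ρ ![z, (0, f 2), (0, f 0)] = - ρ ![z, (0, f 0), (0, f 2)] :=
    fun z => alt₃_swap₂ ..
  have f21 : ∀ z, ρ ![z, (0, f 2), (0, f 1)] = - ρ ![z, (0, f 1), (0, f 2)] :=
    fun z => alt₃_swap₂ ..
  obtain ⟨a12, a02, a01⟩ := hA.prod_left (L₂ := L₂)
  obtain ⟨b12, b02, b01⟩ := hB.prod_right (L₁ := L₁)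
  obtain ⟨s0, s1, s2, s3, s4, s5⟩ := sumBasis_apply e f
  rw [isClosedForm_three_iff e f, forall_strictMono_fin_four_six (P := fun i j k l =>
    lieExtDeriv ρ ![sumBasis e f i, sumBasis e f j, sumBasis e f k, sumBasis e f l] = 0)]
  simp only [s0, s1, s2, s3, s4, s5, lieExtDeriv_three, Matrix.cons_val, prod_lie_left_right,
    a12, a02, a01, b12, b02, b01, alt₃_add₁, alt₃_smul₁, z1, sw1, sw2, alt₃_self₁, alt₃_self₂,
    e10, e20, e21, f10, f20, f21, h.p0, h.p1, h.p2, h.q0, h.q1, h.q2, smul_eq_mul,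
    Fin.forall_fin_succ, Fin.sum_univ_three, divergence, Fin.succ_zero_eq_one, Fin.succ_one_eq_two,
    IsEmpty.forall_iff, and_true]
  constructor
  · rintro ⟨h1, h2, h3, h4, h5, h6, h7, h8, h9, h10, h11, h12, h13, h14, h15⟩
    refine ⟨⟨?_, ?_, ?_⟩, ⟨?_, ?_, ?_⟩, ⟨?_, ?_, ?_⟩, ⟨?_, ?_, ?_⟩, ?_, ?_, ?_⟩ <;> linarith
  · rintro ⟨⟨h1, h2, h3⟩, ⟨h4, h5, h6⟩, ⟨h7, h8, h9⟩, ⟨h10, h11, h12⟩, h13, h14, h15⟩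
    refine ⟨?_, ?_, ?_, ?_, ?_, ?_, ?_, ?_, ?_, ?_, ?_, ?_, ?_, ?_, ?_⟩ <;> linarith

/-- The two groups of equations are the components of `dβ` of bidegree `(3,2)` and `(2,3)`. -/
theorem isClosedForm_iff_of_fourFormTable (hA : HasStructure e A) (hB : HasStructure f B)
    {β : (L₁ × L₂) [⋀^Fin 4]→ₗ[ℝ] ℝ} {m : Fin 3 → Fin 3 → ℝ} {n o : Fin 3 → ℝ}
    (h : FourFormTable e f β m n o) :
    IsClosedForm β ↔
      (∀ k, ∑ j, m j k * divergence A j - ∑ i, n i * B i k = 0) ∧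
      (∀ j, ∑ k, m j k * divergence B k + ∑ l, o l * A l j = 0) := by
  have z1 : ∀ y z w, β ![0, y, z, w] = 0 := fun y z w => β.map_coord_zero 0 (m := _) rfl
  have sw1 : ∀ (y : L₂) (x : L₁) z w, β ![(0, y), (x, 0), z, w] = - β ![(x, 0), (0, y), z, w] :=
    fun y x z w => alt₄_swap₁ ..
  have sw2' : ∀ x' (x : L₁) (y : L₂) w, β ![x', (0, y), (x, 0), w] = - β ![x', (x, 0), (0, y), w] :=
    fun x' x y w => alt₄_swap₂ ..
  have sw3 : ∀ x' x'' (x : L₁) (y : L₂),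
      β ![x', x'', (0, y), (x, 0)] = - β ![x', x'', (x, 0), (0, y)] := fun x' x y w => alt₄_swap₃ ..
  have d1 : ∀ x y z, β ![x, x, y, z] = 0 := fun p r s =>
      β.map_eq_zero_of_eq _ (i := 0) (j := 1) rfl (by decide)
  have d3 : ∀ x y z, β ![y, z, x, x] = 0 := fun p r s =>
      β.map_eq_zero_of_eq _ (i := 2) (j := 3) rfl (by decide)
  have e10 : ∀ z w, β ![(e 1, 0), (e 0, 0), z, w] = - β ![(e 0, 0), (e 1, 0), z, w] :=
    fun z w => alt₄_swap₁ ..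
  have e20 : ∀ z w, β ![(e 2, 0), (e 0, 0), z, w] = - β ![(e 0, 0), (e 2, 0), z, w] :=
    fun z w => alt₄_swap₁ ..
  have e21 : ∀ z w, β ![(e 2, 0), (e 1, 0), z, w] = - β ![(e 1, 0), (e 2, 0), z, w] :=
    fun z w => alt₄_swap₁ ..
  have f10' : ∀ z w, β ![z, w, (0, f 1), (0, f 0)] = - β ![z, w, (0, f 0), (0, f 1)] :=
    fun z w => alt₄_swap₃ ..
  have f20' : ∀ z w, β ![z, w, (0, f 2), (0, f 0)] = - β ![z, w, (0, f 0), (0, f 2)] :=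
    fun z w => alt₄_swap₃ ..
  have f21' : ∀ z w, β ![z, w, (0, f 2), (0, f 1)] = - β ![z, w, (0, f 1), (0, f 2)] :=
    fun z w => alt₄_swap₃ ..
  obtain ⟨a12, a02, a01⟩ := hA.prod_left (L₂ := L₂)
  obtain ⟨b12, b02, b01⟩ := hB.prod_right (L₁ := L₁)
  obtain ⟨s0, s1, s2, s3, s4, s5⟩ := sumBasis_apply e f
  rw [isClosedForm_four_iff e f, forall_strictMono_fin_five_six (P := fun i j k l m =>
    lieExtDeriv β ![sumBasis e f i, sumBasis e f j, sumBasis e f k, sumBasis e f l,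
      sumBasis e f m] = 0)]
  simp only [s0, s1, s2, s3, s4, s5, lieExtDeriv_four, Matrix.cons_val, prod_lie_left_right,
    a12, a02, a01, b12, b02, b01, alt₄_add₁, alt₄_smul₁, z1, sw1, sw2', sw3, d1, d3,
    e10, e20, e21, f10', f20', f21',
    h.m00, h.m01, h.m02, h.m10, h.m11, h.m12, h.m20, h.m21, h.m22, h.n, h.o, smul_eq_mul,
    Fin.forall_fin_succ, Fin.sum_univ_three, divergence, Fin.succ_zero_eq_one, Fin.succ_one_eq_two,
    IsEmpty.forall_iff, and_true]
  constructor
  · rintro ⟨h1, h2, h3, h4, h5, h6⟩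
    refine ⟨⟨?_, ?_, ?_⟩, ?_, ?_, ?_⟩ <;> linarith
  · rintro ⟨⟨h1, h2, h3⟩, h4, h5, h6⟩
    refine ⟨?_, ?_, ?_, ?_, ?_, ?_⟩ <;> linarith

end ClosedForms

/-! ### The normal form, its `(3,0)`-forms and the half-flat equations -/

section NormalForm

theorem vec_eq_three {M : Type*} (w : Fin 3 → M) : w = ![w 0, w 1, w 2] := by
  ext i; fin_cases i <;> rfl

variable {L₁ L₂ : Type*} [LieRing L₁] [LieAlgebra ℝ L₁] [LieRing L₂] [LieAlgebra ℝ L₂]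

namespace SL3RStructure

/-- The bases `e` and `f` (with squares `-σ` and `σ`) exhibit the normal form of `ω` with
parameter `a`. -/
def IsNormalPair (S : SL3RStructure (L₁ × L₂)) (a σ : ℝ) (e : Module.Basis (Fin 3) ℝ L₁)
    (f : Module.Basis (Fin 3) ℝ L₂) : Prop :=
  (σ = 1 ∨ σ = -1) ∧
  (∀ i j, S.g (e i, 0) (e j, 0) = if i = j then -σ else 0) ∧
  (∀ i j, S.g (0, f i) (0, f j) = if i = j then σ else 0) ∧
  (∀ i j, S.g (e i, 0) (0, f j) = 0) ∧
  (∀ i j, S.ω ![(e i, 0), (e j, 0)] = !![0, a, 0; -a, 0, 0; 0, 0, 0] i j) ∧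
  (∀ i j, S.ω ![(e i, 0), (0, f j)] =
    !![√(1 + a ^ 2), 0, 0; 0, √(1 + a ^ 2), 0; 0, 0, 1] i j) ∧
  (∀ i j, S.ω ![(0, f i), (0, f j)] = !![0, a, 0; -a, 0, 0; 0, 0, 0] i j)

/-- The imaginary part of `Ψ`. -/
noncomputable def imPart {V : Type*} [AddCommGroup V] [Module ℝ V] (S : SL3RStructure V) :
    V [⋀^Fin 3]→ₗ[ℝ] ℝ :=
  (QuadraticAlgebra.imₗ (R := ℝ) 1 0).compAlternatingMap S.Ψ

theorem rePart_J {V : Type*} [AddCommGroup V] [Module ℝ V] (S : SL3RStructure V) (x y z : V) :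
    S.rePart ![S.J x, y, z] = S.imPart ![x, y, z] := by
  change (S.Ψ ![S.J x, y, z]).re = (S.Ψ ![x, y, z]).im
  rw [S.Ψ_type]; simp [ParaComplex.e]

theorem imPart_J {V : Type*} [AddCommGroup V] [Module ℝ V] (S : SL3RStructure V) (x y z : V) :
    S.imPart ![S.J x, y, z] = S.rePart ![x, y, z] := by
  change (S.Ψ ![S.J x, y, z]).im = (S.Ψ ![x, y, z]).re
  rw [S.Ψ_type]; simp [ParaComplex.e]

variable {S : SL3RStructure (L₁ × L₂)} {a σ : ℝ} {e : Module.Basis (Fin 3) ℝ L₁}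
  {f : Module.Basis (Fin 3) ℝ L₂}

theorem ω_swap {V : Type*} [AddCommGroup V] [Module ℝ V] (S : SL3RStructure V) (x y : V) :
    S.ω ![y, x] = - S.ω ![x, y] := by
  rw [← S.ω.map_swap ![x, y] (i := 0) (j := 1) (by decide)]
  congr 1; ext i; fin_cases i <;> rfl

/-- In a pseudo-orthonormal basis the coordinates of `J v` are, up to the signs of the basis
vectors, the pairings `g(·, J v) = ω(·, v)`. -/
theorem IsNormalPair.J_eq (h : S.IsNormalPair a σ e f) (v : L₁ × L₂) :
    S.J v = ∑ i, (-σ * S.ω ![(e i, 0), v]) • (e i, (0 : L₂)) +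
      ∑ i, (σ * S.ω ![(0, f i), v]) • ((0 : L₁), f i) := by
  obtain ⟨hσ, he, hf, hef, -⟩ := h
  have hσ2 : σ * σ = 1 := by rcases hσ with rfl | rfl <;> norm_num
  set x := e.repr (S.J v).1
  set y := f.repr (S.J v).2
  have hJ : S.J v = ∑ i, x i • (e i, (0 : L₂)) + ∑ i, y i • ((0 : L₁), f i) := by
    ext
    · have := e.sum_repr (S.J v).1
      rw [Fin.sum_univ_three] at this
      simp only [Fin.sum_univ_three, x]
      simpa using this.symm
    · have := f.sum_repr (S.J v).2
      rw [Fin.sum_univ_three] at this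
      simp only [Fin.sum_univ_three, y]
      simpa using this.symm
  have hx : ∀ i, S.ω ![(e i, 0), v] = -σ * x i := fun i => by
    rw [S.ω_eq, hJ]
    simp only [map_add, map_sum, map_smul, he, hef, smul_eq_mul]
    simp [mul_comm]
  have hy : ∀ i, S.ω ![(0, f i), v] = σ * y i := fun i => by
    rw [S.ω_eq, hJ]
    simp only [map_add, map_sum, map_smul, hf, S.g_symm (0, f i) (e _, 0), hef, smul_eq_mul]
    simp [mul_comm]
  rw [hJ]
  congr 1 <;> refine Finset.sum_congr rfl fun i _ => ?_
  · rw [hx, ← mul_assoc, neg_mul_neg, hσ2, one_mul]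
  · rw [hy, ← mul_assoc, hσ2, one_mul]

theorem IsNormalPair.J_apply (h : S.IsNormalPair a σ e f) :
    S.J (e 0, 0) = (σ * a) • (e 1, 0) - (σ * √(1 + a ^ 2)) • (0, f 0) ∧
    S.J (e 1, 0) = - (σ * a) • (e 0, 0) - (σ * √(1 + a ^ 2)) • (0, f 1) ∧
    S.J (e 2, 0) = - σ • (0, f 2) := by
  have hJ := h.J_eq
  obtain ⟨-, -, -, -, h1, h2, -⟩ := h
  refine ⟨?_, ?_, ?_⟩ <;> rw [hJ] <;>
    simp only [Fin.sum_univ_three, h1, S.ω_swap (e _, 0) (0, f _), h2] <;> simp [sub_eq_add_neg]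

/-- This solves `J_apply` for the `fᵢ`, which is possible since `√(1 + a²) ≠ 0`. Hence the `eᵢ`
generate the whole space under `J`. -/
theorem IsNormalPair.right_eq (h : S.IsNormalPair a σ e f) :
    ((0 : L₁), f 0) = (a / √(1 + a ^ 2)) • (e 1, 0) + (-(σ / √(1 + a ^ 2))) • S.J (e 0, 0) ∧
    ((0 : L₁), f 1) = (-(a / √(1 + a ^ 2))) • (e 0, 0) + (-(σ / √(1 + a ^ 2))) • S.J (e 1, 0) ∧
    ((0 : L₁), f 2) = (-σ) • S.J (e 2, 0) := by
  have hc : √(1 + a ^ 2) ≠ 0 := by positivity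
  have hσ2 : σ * σ = 1 := by rcases h.1 with rfl | rfl <;> norm_num
  obtain ⟨h0, h1, h2⟩ := h.J_apply
  have hσ3 : σ ^ 2 = 1 := by rw [sq, hσ2]
  refine ⟨?_, ?_, ?_⟩
  · rw [h0]; match_scalars <;> field_simp <;> simp [hσ3]
  · rw [h1]; match_scalars <;> field_simp <;> simp [hσ3]
  · rw [h2]; match_scalars; simp [hσ2]

/-- The components of `Re Ψ` in terms of the two real parameters `s` and `t`. -/
theorem IsNormalPair.threeFormTable (h : S.IsNormalPair a σ e f) {s t : ℝ}
    (hs : S.rePart ![(e 0, 0), (e 1, 0), (e 2, 0)] = √(1 + a ^ 2) * s)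
    (ht : S.imPart ![(e 0, 0), (e 1, 0), (e 2, 0)] = -σ * √(1 + a ^ 2) * t) :
    ThreeFormTable e f S.rePart
      !![t, s * a, 0; -(s * a), t, 0; 0, 0, t * √(1 + a ^ 2)]
      !![s, t * a, 0; -(t * a), s, 0; 0, 0, s * √(1 + a ^ 2)] := by
  have hc : √(1 + a ^ 2) ≠ 0 := by positivity
  have hc2 : √(1 + a ^ 2) ^ 2 = 1 + a ^ 2 := Real.sq_sqrt (by positivity)
  have hσ2 : σ ^ 2 = 1 := by rcases h.1 with rfl | rfl <;> norm_num
  obtain ⟨f0, f1, f2⟩ := h.right_eq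
  generalize √(1 + a ^ 2) = c at *
  have key : ∀ α : (L₁ × L₂) [⋀^Fin 3]→ₗ[ℝ] ℝ,
      (∀ x y z, α ![(x, 0), (0, y), z] = - α ![(0, y), (x, 0), z]) ∧
      (∀ x y z, α ![z, (x, 0), (0, y)] = - α ![z, (0, y), (x, 0)]) ∧
      (∀ z, α ![(e 1, 0), (e 0, 0), z] = - α ![(e 0, 0), (e 1, 0), z]) ∧
      (∀ z, α ![(e 2, 0), (e 0, 0), z] = - α ![(e 0, 0), (e 2, 0), z]) ∧
      (∀ z, α ![(e 2, 0), (e 1, 0), z] = - α ![(e 1, 0), (e 2, 0), z]) ∧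
      (∀ z, α ![z, (e 2, 0), (e 1, 0)] = - α ![z, (e 1, 0), (e 2, 0)]) ∧
      (∀ z, α ![z, (e 1, 0), (e 0, 0)] = - α ![z, (e 0, 0), (e 1, 0)]) ∧
      (∀ z, α ![z, (e 2, 0), (e 0, 0)] = - α ![z, (e 0, 0), (e 2, 0)]) :=
    fun α => ⟨fun _ _ _ => alt₃_swap₁ .., fun _ _ _ => alt₃_swap₂ .., fun _ => alt₃_swap₁ ..,
      fun _ => alt₃_swap₁ .., fun _ => alt₃_swap₁ .., fun _ => alt₃_swap₂ ..,
      fun _ => alt₃_swap₂ .., fun _ => alt₃_swap₂ ..⟩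
  -- An `fᵢ` moved to the first slot is a combination of some `eⱼ` and `J eᵢ`, and `J` in that slot
  -- exchanges `Re Ψ` and `Im Ψ`. This reduces every component to the values on `e₁, e₂, e₃`.
  have r0 : ∀ y z, S.rePart ![(0, f 0), y, z] =
      a / c * S.rePart ![(e 1, 0), y, z] - σ / c * S.imPart ![(e 0, 0), y, z] := fun y z => by
    rw [f0, alt₃_add₁, alt₃_smul₁, alt₃_smul₁, rePart_J]; simp [sub_eq_add_neg]
  have r1 : ∀ y z, S.rePart ![(0, f 1), y, z] =
      -(a / c * S.rePart ![(e 0, 0), y, z]) - σ / c * S.imPart ![(e 1, 0), y, z] := fun y z => by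
    rw [f1, alt₃_add₁, alt₃_smul₁, alt₃_smul₁, rePart_J]; simp [sub_eq_add_neg]
  have r2 : ∀ y z, S.rePart ![(0, f 2), y, z] = - σ * S.imPart ![(e 2, 0), y, z] := fun y z => by
    rw [f2, alt₃_smul₁, rePart_J]; simp
  have i1 : ∀ y z, S.imPart ![(0, f 1), y, z] =
      -(a / c * S.imPart ![(e 0, 0), y, z]) - σ / c * S.rePart ![(e 1, 0), y, z] := fun y z => by
    rw [f1, alt₃_add₁, alt₃_smul₁, alt₃_smul₁, imPart_J]; simp [sub_eq_add_neg]
  have i2 : ∀ y z, S.imPart ![(0, f 2), y, z] = - σ * S.rePart ![(e 2, 0), y, z] := fun y z => by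
    rw [f2, alt₃_smul₁, imPart_J]; simp
  obtain ⟨k1, k2, k3, k4, k5, k6, k7, k8⟩ := key S.rePart
  obtain ⟨l1, -, l3, l4, l5, l6, l7, l8⟩ := key S.imPart
  constructor <;> intro i <;> fin_cases i <;>
  simp [k1, k2, k3, k4, k5, k6, k7, k8, l1, l3, l4, l5, l6, l7, l8,
      alt₃_self₁, alt₃_self₂, r0, r1, r2, i1, i2, hs, ht] <;>
    field_simp <;> (try simp only [hσ2]) <;> first | ring1 | linear_combination (-s) * hc2

/-- The components of `ω ∧ ω`. -/
theorem IsNormalPair.fourFormTable (h : S.IsNormalPair a σ e f) :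
    FourFormTable e f S.omegaSq
      !![-2 * √(1 + a ^ 2), 0, 0; 0, -2 * √(1 + a ^ 2), 0; 0, 0, -2]
      ![0, 0, 2 * a] ![0, 0, 2 * a] := by
  have hc2 : √(1 + a ^ 2) ^ 2 = 1 + a ^ 2 := Real.sq_sqrt (by positivity)
  obtain ⟨-, -, -, -, h1, h2, h3⟩ := h
  have key : ∀ x y z w, S.omegaSq ![x, y, z, w] = 2 * (S.ω ![x, y] * S.ω ![z, w] -
      S.ω ![x, z] * S.ω ![y, w] + S.ω ![x, w] * S.ω ![y, z]) := formWedge_two_two S.ω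
  generalize √(1 + a ^ 2) = c at *
  constructor <;> (try intro i; fin_cases i) <;> simp only [key, h1, h2, h3] <;>
    simp <;> linear_combination (-2) * hc2

/-- The half-flat equations in the structure constants. -/
structure HalfFlatEqs (a c s t : ℝ) (A B : Fin 3 → Fin 3 → ℝ) : Prop where
  r1 : t * divergence A 0 + s * a * divergence A 1 = 0
  r2 : -(s * a) * divergence A 0 + t * divergence A 1 = 0
  r3 : t * c * divergence A 2 = 0
  l1 : s * divergence B 0 - t * a * divergence B 1 = 0
  l2 : t * a * divergence B 0 + s * divergence B 1 = 0
  l3 : s * c * divergence B 2 = 0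
  m00 : t * B 0 0 - s * a * B 1 0 + s * A 0 0 + t * a * A 1 0 = 0
  m01 : t * B 0 1 - s * a * B 1 1 - t * a * A 0 0 + s * A 1 0 = 0
  m02 : t * B 0 2 - s * a * B 1 2 + s * c * A 2 0 = 0
  m10 : s * a * B 0 0 + t * B 1 0 + s * A 0 1 + t * a * A 1 1 = 0
  m11 : s * a * B 0 1 + t * B 1 1 - t * a * A 0 1 + s * A 1 1 = 0
  m12 : s * a * B 0 2 + t * B 1 2 + s * c * A 2 1 = 0
  m20 : t * c * B 2 0 + s * A 0 2 + t * a * A 1 2 = 0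
  m21 : t * c * B 2 1 - t * a * A 0 2 + s * A 1 2 = 0
  m22 : t * c * B 2 2 + s * c * A 2 2 = 0
  w0 : c * divergence A 0 + a * B 2 0 = 0
  w1 : c * divergence A 1 + a * B 2 1 = 0
  w2 : divergence A 2 + a * B 2 2 = 0
  z0 : c * divergence B 0 - a * A 2 0 = 0
  z1 : c * divergence B 1 - a * A 2 1 = 0
  z2 : divergence B 2 - a * A 2 2 = 0

theorem IsNormalPair.isHalfFlat_iff (h : S.IsNormalPair a σ e f) {s t : ℝ}
    (hs : S.rePart ![(e 0, 0), (e 1, 0), (e 2, 0)] = √(1 + a ^ 2) * s)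
    (ht : S.imPart ![(e 0, 0), (e 1, 0), (e 2, 0)] = -σ * √(1 + a ^ 2) * t)
    {A B : Fin 3 → Fin 3 → ℝ} (hA : HasStructure e A) (hB : HasStructure f B) :
    S.IsHalfFlat ↔ HalfFlatEqs a √(1 + a ^ 2) s t A B := by
  rw [IsHalfFlat, isClosedForm_iff_of_threeFormTable hA hB (h.threeFormTable hs ht),
    isClosedForm_iff_of_fourFormTable hA hB h.fourFormTable]
  generalize √(1 + a ^ 2) = c
  simp [Fin.forall_fin_succ, Fin.sum_univ_three]
  constructor
  · rintro ⟨⟨⟨h1, h2, h3⟩, ⟨h4, h5, h6⟩, ⟨h7, h8, h9⟩, ⟨h10, h11, h12⟩, h13, h14, h15⟩,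
      ⟨h16, h17, h18⟩, h19, h20, h21⟩
    constructor <;> (try simp only [mul_eq_zero]) <;> (try assumption) <;> linarith
  · rintro ⟨h1, h2, h3, h4, h5, h6, h7, h8, h9, h10, h11, h12, h13, h14, h15, h16, h17, h18, h19,
      h20, h21⟩
    simp only [mul_eq_zero] at h3 h6
    refine ⟨⟨⟨?_, ?_, ?_⟩, ⟨?_, ?_, ?_⟩, ⟨?_, ?_, ?_⟩, ⟨?_, ?_, ?_⟩, ?_, ?_, ?_⟩,
      ⟨?_, ?_, ?_⟩, ?_, ?_, ?_⟩ <;> (try assumption) <;> linarith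

/-- A form of type `(3,0)` is determined by its value on `e₁, e₂, e₃`. -/
theorem IsNormalPair.eq_zero_of_type (h : S.IsNormalPair a σ e f)
    (Φ : (L₁ × L₂) [⋀^Fin 3]→ₗ[ℝ] ParaComplex)
    (hΦ : ∀ x y z, Φ ![S.J x, y, z] = ParaComplex.e * Φ ![x, y, z])
    (h0 : Φ ![(e 0, 0), (e 1, 0), (e 2, 0)] = 0) : Φ = 0 := by
  have span : ∀ W : Submodule ℝ (L₁ × L₂), (∀ x ∈ W, S.J x ∈ W) → (∀ i, (e i, 0) ∈ W) →
      ∀ v, v ∈ W := by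
    intro W hJ he v
    obtain ⟨f0, f1, f2⟩ := h.right_eq
    have hf : ∀ i, ((0 : L₁), f i) ∈ W := by
      intro i
      fin_cases i
      · exact f0 ▸ W.add_mem (W.smul_mem _ (he _)) (W.smul_mem _ (hJ _ (he _)))
      · exact f1 ▸ W.add_mem (W.smul_mem _ (he _)) (W.smul_mem _ (hJ _ (he _)))
      · exact f2 ▸ W.smul_mem _ (hJ _ (he _))
    have : v = ∑ i, e.repr v.1 i • (e i, (0 : L₂)) + ∑ i, f.repr v.2 i • ((0 : L₁), f i) := by
      have h1 := e.sum_repr v.1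
      have h2 := f.sum_repr v.2
      rw [Fin.sum_univ_three] at h1 h2
      ext
      · simpa [Fin.sum_univ_three] using h1.symm
      · simpa [Fin.sum_univ_three] using h2.symm
    rw [this]
    exact W.add_mem (W.sum_mem fun i _ => W.smul_mem _ (he i))
      (W.sum_mem fun i _ => W.smul_mem _ (hf i))
  -- The kernel in the first slot is `J`-invariant since `Φ(J·) = e Φ`; if it contains the `eᵢ`, it
  -- is everything. Antisymmetry then lets the slots be freed one at a time.
  have lin : ∀ y z, ∃ W : Submodule ℝ (L₁ × L₂), (∀ x, x ∈ W ↔ Φ ![x, y, z] = 0) ∧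
      ∀ x ∈ W, S.J x ∈ W := fun y z => by
    refine ⟨⟨⟨⟨{x | Φ ![x, y, z] = 0}, ?_⟩, ?_⟩, ?_⟩, fun x => Iff.rfl, ?_⟩
    · intro x x' hx hx'
      simp only [Set.mem_ofPred_eq] at hx hx' ⊢
      rw [alt₃_add₁, hx, hx', add_zero]
    · exact Φ.map_coord_zero 0 (m := _) rfl
    · intro c x hx
      simp only [Set.mem_ofPred_eq] at hx ⊢
      rw [alt₃_smul₁, hx, smul_zero]
    · intro x (hx : Φ ![x, y, z] = 0)
      change Φ ![S.J x, y, z] = 0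
      rw [hΦ, hx, mul_zero]
  have step : ∀ y z, (∀ i, Φ ![(e i, 0), y, z] = 0) → ∀ x, Φ ![x, y, z] = 0 := by
    intro y z hi x
    obtain ⟨W, hW, hJ⟩ := lin y z
    exact (hW x).mp (span W hJ (fun i => (hW _).mpr (hi i)) x)
  have b3 : ∀ i j k, Φ ![(e i, 0), (e j, 0), (e k, 0)] = 0 := by
    have e10 : ∀ z, Φ ![(e 1, 0), (e 0, 0), z] = - Φ ![(e 0, 0), (e 1, 0), z] :=
      fun z => alt₃_swap₁ ..
    have e20 : ∀ z, Φ ![(e 2, 0), (e 0, 0), z] = - Φ ![(e 0, 0), (e 2, 0), z] :=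
      fun z => alt₃_swap₁ ..
    have e21 : ∀ z, Φ ![z, (e 2, 0), (e 1, 0)] = - Φ ![z, (e 1, 0), (e 2, 0)] :=
      fun z => alt₃_swap₂ ..
    have e20' : ∀ z, Φ ![z, (e 2, 0), (e 0, 0)] = - Φ ![z, (e 0, 0), (e 2, 0)] :=
      fun z => alt₃_swap₂ ..
    intro i j k
    have e21' : ∀ z, Φ ![(e 2, 0), (e 1, 0), z] = - Φ ![(e 1, 0), (e 2, 0), z] :=
      fun z => alt₃_swap₁ ..
    fin_cases i <;> fin_cases j <;> fin_cases k <;>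
      simp [alt₃_self₁, alt₃_self₂, alt₃_self₃, e10, e20, e21, e20', e21', h0]
  have b2 : ∀ x j k, Φ ![x, (e j, 0), (e k, 0)] = 0 := fun x j k =>
    step _ _ (fun i => b3 i j k) x
  have b1 : ∀ x y k, Φ ![x, y, (e k, 0)] = 0 := fun x y k =>
    step _ _ (fun i => by rw [alt₃_swap₁, b2, neg_zero]) x
  have b0 : ∀ x y z, Φ ![x, y, z] = 0 := fun x y z =>
    step _ _ (fun i => by rw [alt₃_swap₁, alt₃_swap₂, b1]; simp) x
  refine AlternatingMap.ext fun v => ?_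
  rw [vec_eq_three v, b0]
  rfl

/-- If `w = Ψ(e₁,e₂,e₃)` were null, some `κ ≠ 0` would satisfy `κ w = 0`. Then `κ Ψ` is a
`(3,0)`-form vanishing on `e₁, e₂, e₃`, hence zero, so every value of `Ψ` is a zero divisor and has
norm zero, against the non-zero length. -/
theorem IsNormalPair.norm_ne_zero (h : S.IsNormalPair a σ e f) :
    QuadraticAlgebra.norm (S.Ψ ![(e 0, 0), (e 1, 0), (e 2, 0)]) ≠ 0 := by
  intro h0
  set w := S.Ψ ![(e 0, 0), (e 1, 0), (e 2, 0)] with hw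
  obtain ⟨κ, hκ0, hκ⟩ : ∃ κ : ParaComplex, κ ≠ 0 ∧ κ * w = 0 := by
    by_cases hw0 : w = 0
    · exact ⟨1, one_ne_zero, by rw [hw0, mul_zero]⟩
    · refine ⟨star w, star_ne_zero.mpr hw0, ?_⟩
      rw [mul_comm, ← QuadraticAlgebra.algebraMap_norm_eq_mul_star, h0, map_zero]
  have hz := h.eq_zero_of_type ((LinearMap.mulLeft ℝ κ).compAlternatingMap S.Ψ)
    (fun x y z => by
      simp only [LinearMap.compAlternatingMap_apply, LinearMap.mulLeft_apply, S.Ψ_type]; ring) hκ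
  have hn : ∀ v, QuadraticAlgebra.norm (S.Ψ v) = 0 := fun v => by
    by_contra hne
    have hu : IsUnit (S.Ψ v) :=
      QuadraticAlgebra.isUnit_iff_norm_isUnit.mpr (isUnit_iff_ne_zero.mpr hne)
    have h1 : κ * S.Ψ v = 0 := congrArg (fun A => A v) hz
    exact hκ0 (hu.mul_left_eq_zero.mp h1)
  obtain ⟨b, -, hb⟩ := S.neutral_length
  exact hb (by simp [lengthSq, hn])

end SL3RStructure

end NormalForm

/-! ### A model realising the normal form with any non-null `Ψ` -/

section Model

/-- The neutral metric `-∑ (eⁱ)² + ∑ (fⁱ)²` on `ℝ³ × ℝ³`. -/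
noncomputable def modelMetric : LinearMap.BilinForm ℝ ((Fin 3 → ℝ) × (Fin 3 → ℝ)) :=
  LinearMap.mk₂ ℝ (fun u v => - ∑ i, u.1 i * v.1 i + ∑ i, u.2 i * v.2 i)
    (fun u u' v => by simp [Fin.sum_univ_three]; ring)
    (fun k u v => by simp [Fin.sum_univ_three]; ring)
    (fun u v v' => by simp [Fin.sum_univ_three]; ring)
    (fun k u v => by simp [Fin.sum_univ_three]; ring)

theorem modelMetric_apply (u v : (Fin 3 → ℝ) × (Fin 3 → ℝ)) :
    modelMetric u v = - ∑ i, u.1 i * v.1 i + ∑ i, u.2 i * v.2 i := rfl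

/-- The para-complex structure of the normal form. -/
def modelJ (a c : ℝ) : (Fin 3 → ℝ) × (Fin 3 → ℝ) →ₗ[ℝ] (Fin 3 → ℝ) × (Fin 3 → ℝ) where
  toFun u := (![-a * u.1 1 - c * u.2 0, a * u.1 0 - c * u.2 1, -u.2 2],
    ![-c * u.1 0 + a * u.2 1, -c * u.1 1 - a * u.2 0, -u.1 2])
  map_add' u v := by
    ext i <;> fin_cases i <;> simp <;> ring
  map_smul' k u := by
    ext i <;> fin_cases i <;> simp <;> ring

theorem modelJ_apply (a c : ℝ) (u : (Fin 3 → ℝ) × (Fin 3 → ℝ)) :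
    modelJ a c u = (![-a * u.1 1 - c * u.2 0, a * u.1 0 - c * u.2 1, -u.2 2],
    ![-c * u.1 0 + a * u.2 1, -c * u.1 1 - a * u.2 0, -u.1 2]) := rfl

theorem modelJ_modelJ {a c : ℝ} (h : c ^ 2 = 1 + a ^ 2) (u : (Fin 3 → ℝ) × (Fin 3 → ℝ)) :
    modelJ a c (modelJ a c u) = u := by
  ext i <;> fin_cases i <;> simp [modelJ_apply]
  · linear_combination u.1 0 * h
  · linear_combination u.1 1 * h
  · linear_combination u.2 0 * h
  · linear_combination u.2 1 * h

theorem modelMetric_modelJ {a c : ℝ} (h : c ^ 2 = 1 + a ^ 2) (u v : (Fin 3 → ℝ) × (Fin 3 → ℝ)) :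
    modelMetric (modelJ a c u) (modelJ a c v) = - modelMetric u v := by
  simp [modelMetric_apply, modelJ_apply, Fin.sum_univ_three]
  linear_combination (u.1 0 * v.1 0 + u.1 1 * v.1 1 - u.2 0 * v.2 0 - u.2 1 * v.2 1) * h

/-- The fundamental two-form of the normal form. -/
noncomputable def modelω (a c : ℝ) : ((Fin 3 → ℝ) × (Fin 3 → ℝ)) [⋀^Fin 2]→ₗ[ℝ] ℝ where
  toFun v := modelMetric (v 0) (modelJ a c (v 1))
  map_update_add' := by
    intro inst X i v v'
    obtain rfl : inst = instDecidableEqFin _ := Subsingleton.elim _ _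
    fin_cases i <;> simp [Function.update]
  map_update_smul' := by
    intro inst X i v v'
    obtain rfl : inst = instDecidableEqFin _ := Subsingleton.elim _ _
    fin_cases i <;> simp [Function.update]
  map_eq_zero_of_eq' v i j h hij := by
    have h01 : v 0 = v 1 := by
      fin_cases i <;> fin_cases j <;> simp at h hij ⊢ <;> simp [h]
    rw [h01]
    simp [modelMetric_apply, modelJ_apply, Fin.sum_univ_three]
    ring

/-- The `(1,0)`-forms `eⁱ + e J^*eⁱ`. -/
def modelθ (a c : ℝ) : (Fin 3 → ℝ) × (Fin 3 → ℝ) →ₗ[ℝ] (Fin 3 → ParaComplex) where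
  toFun u i := ⟨u.1 i, (modelJ a c u).1 i⟩
  map_add' u v := by ext i <;> simp
  map_smul' k u := by ext i <;> simp

theorem modelθ_apply (a c : ℝ) (u : (Fin 3 → ℝ) × (Fin 3 → ℝ)) (i : Fin 3) :
    modelθ a c u i = ⟨u.1 i, (modelJ a c u).1 i⟩ := rfl

/-- The determinant of para-complex matrices as a real alternating map. -/
noncomputable def paraComplexDet : (Fin 3 → ParaComplex) [⋀^Fin 3]→ₗ[ℝ] ParaComplex :=
  { (Matrix.detRowAlternating (R := ParaComplex) (n := Fin 3)).toMultilinearMap.restrictScalars ℝ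
      with
    map_eq_zero_of_eq' := fun v _ _ h hij =>
      (Matrix.detRowAlternating (R := ParaComplex) (n := Fin 3)).map_eq_zero_of_eq v h hij }

/-- The determinant of three para-complex row vectors. -/
def det₃ (x y z : Fin 3 → ParaComplex) : ParaComplex :=
  x 0 * y 1 * z 2 - x 0 * y 2 * z 1 - x 1 * y 0 * z 2 + x 1 * y 2 * z 0 + x 2 * y 0 * z 1 -
    x 2 * y 1 * z 0

/-- The `(3,0)`-forms of the normal form. -/
noncomputable def modelΨ (a c : ℝ) (w : ParaComplex) :
    ((Fin 3 → ℝ) × (Fin 3 → ℝ)) [⋀^Fin 3]→ₗ[ℝ] ParaComplex :=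
  (LinearMap.mulLeft ℝ w).compAlternatingMap (paraComplexDet.compLinearMap (modelθ a c))

theorem modelΨ_apply (a c : ℝ) (w : ParaComplex) (x y z : (Fin 3 → ℝ) × (Fin 3 → ℝ)) :
    modelΨ a c w ![x, y, z] =
      w * det₃ (modelθ a c x) (modelθ a c y) (modelθ a c z) :=
  congrArg (w * ·) (Matrix.det_fin_three (Matrix.of fun i => modelθ a c (![x, y, z] i)))

/-- The basis `f₁, f₂, f₃, e₁, e₂, e₃` of `ℝ³ × ℝ³`. -/
noncomputable def modelBasis : Module.Basis (Fin 3 ⊕ Fin 3) ℝ ((Fin 3 → ℝ) × (Fin 3 → ℝ)) :=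
  ((Pi.basisFun ℝ (Fin 3)).prod (Pi.basisFun ℝ (Fin 3))).reindex (Equiv.sumComm _ _)

theorem modelBasis_inl (i : Fin 3) : modelBasis (Sum.inl i) = (0, Pi.single i 1) := by
  simp [modelBasis, Module.Basis.prod_apply]

theorem modelBasis_inr (i : Fin 3) : modelBasis (Sum.inr i) = (Pi.single i 1, 0) := by
  simp [modelBasis, Module.Basis.prod_apply]

theorem modelΨ_type {a c : ℝ} (h : c ^ 2 = 1 + a ^ 2) (w : ParaComplex)
    (x y z : (Fin 3 → ℝ) × (Fin 3 → ℝ)) :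
    modelΨ a c w ![modelJ a c x, y, z] = ParaComplex.e * modelΨ a c w ![x, y, z] := by
  have hθ : modelθ a c (modelJ a c x) = ParaComplex.e • modelθ a c x := by
    ext i <;> simp [modelθ_apply, modelJ_modelJ h, ParaComplex.e]
  rw [modelΨ_apply, modelΨ_apply, hθ]
  simp only [det₃, Pi.smul_apply, smul_eq_mul]
  ring

theorem isNeutralBasis_modelBasis : IsNeutralBasis modelMetric modelBasis := by
  refine ⟨fun i j => ?_, fun i j => ?_, fun i j => ?_⟩
  all_goals
    simp only [modelBasis_inl, modelBasis_inr, modelMetric_apply]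
    simp [Pi.single_apply, eq_comm]
  split_ifs <;> simp

/-- The factor `-8 (1 + a²)` never vanishes, so the length is non-zero as soon as `w` is not null.
-/
theorem lengthSq_modelΨ {a c : ℝ} (h : c ^ 2 = 1 + a ^ 2) (w : ParaComplex) :
    lengthSq modelMetric modelBasis (modelΨ a c w) =
      -8 * (1 + a ^ 2) * QuadraticAlgebra.norm w := by
  obtain ⟨h1, h2, -⟩ := isNeutralBasis_modelBasis
  have t1 : ∀ i, modelMetric (modelBasis (Sum.inl i)) (modelBasis (Sum.inl i)) = 1 := fun i => by
    rw [h1, if_pos rfl]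
  have t2 : ∀ i, modelMetric (modelBasis (Sum.inr i)) (modelBasis (Sum.inr i)) = -1 := fun i => by
    rw [h2, if_pos rfl]
  have f0 : modelθ a c (modelBasis (Sum.inl 0)) = ![⟨0, -c⟩, 0, 0] := by
    rw [modelBasis_inl]; ext i <;> fin_cases i <;> simp [modelθ_apply, modelJ_apply]
  have f1 : modelθ a c (modelBasis (Sum.inl 1)) = ![0, ⟨0, -c⟩, 0] := by
    rw [modelBasis_inl]; ext i <;> fin_cases i <;> simp [modelθ_apply, modelJ_apply]
  have f2 : modelθ a c (modelBasis (Sum.inl 2)) = ![0, 0, ⟨0, -1⟩] := by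
    rw [modelBasis_inl]; ext i <;> fin_cases i <;> simp [modelθ_apply, modelJ_apply]
  have e0 : modelθ a c (modelBasis (Sum.inr 0)) = ![⟨1, 0⟩, ⟨0, a⟩, 0] := by
    rw [modelBasis_inr]; ext i <;> fin_cases i <;> simp [modelθ_apply, modelJ_apply]
  have e1 : modelθ a c (modelBasis (Sum.inr 1)) = ![⟨0, -a⟩, ⟨1, 0⟩, 0] := by
    rw [modelBasis_inr]; ext i <;> fin_cases i <;> simp [modelθ_apply, modelJ_apply]
  have e2 : modelθ a c (modelBasis (Sum.inr 2)) = ![0, 0, ⟨1, 0⟩] := by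
    rw [modelBasis_inr]; ext i <;> fin_cases i <;> simp [modelθ_apply, modelJ_apply]
  simp only [lengthSq, Fintype.sum_sum_type, Fin.sum_univ_three, modelΨ_apply, map_mul, t1, t2,
    f0, f1, f2, e0, e1, e2, det₃, Matrix.cons_val, QuadraticAlgebra.norm_def]
  simp
  have h4 : c ^ 4 = (1 + a ^ 2) ^ 2 := by rw [← h]; ring
  ring_nf
  simp only [h4, h]
  ring

/-- The `SL(3,ℝ)`-structure of the normal form with parameter `a`. -/
noncomputable def modelStructure (a c : ℝ) (h : c ^ 2 = 1 + a ^ 2) (w : ParaComplex)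
    (hw : QuadraticAlgebra.norm w ≠ 0) : SL3RStructure ((Fin 3 → ℝ) × (Fin 3 → ℝ)) where
  g := modelMetric
  J := modelJ a c
  ω := modelω a c
  Ψ := modelΨ a c w
  g_symm x y := by simp [modelMetric_apply, mul_comm]
  J_sq := modelJ_modelJ h
  J_anti := modelMetric_modelJ h
  ω_eq _ _ := rfl
  Ψ_type := modelΨ_type h w
  neutral_length := ⟨modelBasis, isNeutralBasis_modelBasis, by
    rw [lengthSq_modelΨ h]
    have : 1 + a ^ 2 ≠ 0 := by positivity
    exact mul_ne_zero (mul_ne_zero (by norm_num) this) hw⟩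

/-- Transport of an `SL(3,ℝ)`-structure along a linear equivalence. -/
noncomputable def SL3RStructure.comap {V W : Type*} [AddCommGroup V] [Module ℝ V] [AddCommGroup W]
    [Module ℝ W] (S : SL3RStructure W) (φ : V ≃ₗ[ℝ] W) : SL3RStructure V where
  g := S.g.compl₁₂ φ φ
  J := φ.symm.toLinearMap ∘ₗ S.J ∘ₗ φ.toLinearMap
  ω := S.ω.compLinearMap φ
  Ψ := S.Ψ.compLinearMap φ
  g_symm x y := S.g_symm _ _
  J_sq x := by simp [S.J_sq]
  J_anti x y := by simp [S.J_anti]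
  ω_eq x y := by
    have : (fun i => φ (![x, y] i)) = ![φ x, φ y] := by ext i; fin_cases i <;> rfl
    simp [AlternatingMap.compLinearMap_apply, this, S.ω_eq]
  Ψ_type x y z := by
    have h : ∀ x, (fun i => φ (![x, y, z] i)) = ![φ x, φ y, φ z] := fun x => by
      ext i; fin_cases i <;> rfl
    simp [AlternatingMap.compLinearMap_apply, h, S.Ψ_type]
  neutral_length := by
    obtain ⟨b, hb, hl⟩ := S.neutral_length
    refine ⟨b.map φ.symm, by simpa [IsNeutralBasis] using hb, ?_⟩
    have h : ∀ x y z, (fun i => φ (![φ.symm x, φ.symm y, φ.symm z] i)) = ![x, y, z] :=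
      fun x y z => by funext i; fin_cases i <;> simp
    simpa [lengthSq, AlternatingMap.compLinearMap_apply, h] using hl

variable {L₁ L₂ : Type*} [LieRing L₁] [LieAlgebra ℝ L₁] [LieRing L₂] [LieAlgebra ℝ L₂]

theorem exists_isNormalPair (e : Module.Basis (Fin 3) ℝ L₁) (f : Module.Basis (Fin 3) ℝ L₂)
    (a : ℝ) {s t : ℝ} (hst : s ^ 2 ≠ t ^ 2) :
    ∃ S : SL3RStructure (L₁ × L₂), S.IsNormalPair a 1 e f ∧ S.SummandsOrthogonal ∧
      S.SummandsDefinite ∧ S.rePart ![(e 0, 0), (e 1, 0), (e 2, 0)] = √(1 + a ^ 2) * s ∧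
      S.imPart ![(e 0, 0), (e 1, 0), (e 2, 0)] = -1 * √(1 + a ^ 2) * t := by
  have hc2 : √(1 + a ^ 2) ^ 2 = 1 + a ^ 2 := Real.sq_sqrt (by positivity)
  have hc : √(1 + a ^ 2) ≠ 0 := by positivity
  -- The three `(1,0)`-forms have determinant `1 + a²` on `e₁, e₂, e₃`. The choice `w = (s - e
  -- t)/√(1 + a²)` therefore gives the value `√(1 + a²)(s - e t)`.
  have hw : QuadraticAlgebra.norm (⟨s / √(1 + a ^ 2), -t / √(1 + a ^ 2)⟩ : ParaComplex) ≠ 0 := by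
    have h1 : QuadraticAlgebra.norm (⟨s / √(1 + a ^ 2), -t / √(1 + a ^ 2)⟩ : ParaComplex) =
        (s ^ 2 - t ^ 2) / √(1 + a ^ 2) ^ 2 := by
      rw [QuadraticAlgebra.norm_def]; field_simp; ring
    rw [h1]
    exact div_ne_zero (sub_ne_zero.mpr hst) (pow_ne_zero _ hc)
  set φ : (L₁ × L₂) ≃ₗ[ℝ] (Fin 3 → ℝ) × (Fin 3 → ℝ) := e.equivFun.prodCongr f.equivFun with hφ
  have he : ∀ i, φ (e i, 0) = (Pi.single i 1, 0) := fun i => by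
    ext j <;> simp [hφ, Finsupp.single_apply, Pi.single_apply, eq_comm]
  have hf : ∀ i, φ (0, f i) = (0, Pi.single i 1) := fun i => by
    ext j <;> simp [hφ, Finsupp.single_apply, Pi.single_apply, eq_comm]
  have hpos : ∀ v : Fin 3 → ℝ, v ≠ 0 → 0 < ∑ i, v i * v i := fun v hv => by
    simpa [dotProduct] using Matrix.dotProduct_self_star_pos_iff.mpr hv
  have hg : ∀ x y, ((modelStructure a _ hc2 _ hw).comap φ).g x y = modelMetric (φ x) (φ y) :=
    fun x y => rfl
  have hω : ∀ x y, ((modelStructure a _ hc2 _ hw).comap φ).ω ![x, y] =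
    modelMetric (φ x) (modelJ a √(1 + a ^ 2) (φ y)) := fun x y => rfl
  have hΨ : ((modelStructure a _ hc2 _ hw).comap φ).Ψ ![(e 0, 0), (e 1, 0), (e 2, 0)] =
      ⟨√(1 + a ^ 2) * s, - √(1 + a ^ 2) * t⟩ := by
    have h3 : (fun i => φ ((![(e 0, 0), (e 1, 0), (e 2, 0)] : Fin 3 → L₁ × L₂) i)) =
      ![(Pi.single 0 1, 0), (Pi.single 1 1, 0), (Pi.single 2 1, 0)] := by
        funext i; fin_cases i <;> simp [he]
    change modelΨ _ _ _ (fun i => φ ((![(e 0, 0), (e 1, 0), (e 2, 0)] : Fin 3 → L₁ × L₂) i)) = _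
    rw [h3, modelΨ_apply]
    ext <;> simp [det₃, modelθ_apply, modelJ_apply] <;> field_simp <;> simp [hc2]
  refine ⟨(modelStructure a _ hc2 _ hw).comap φ, ⟨Or.inl rfl, ?_, ?_, ?_, ?_, ?_, ?_⟩,
    ?_, ⟨Or.inr ?_, Or.inl ?_⟩, ?_, ?_⟩
  · intro i j
    rw [hg, he, he]; simp [modelMetric_apply, Pi.single_apply, eq_comm]
    split_ifs <;> simp
  · intro i j
    rw [hg, hf, hf]; simp [modelMetric_apply, Pi.single_apply, eq_comm]
  · intro i j
    rw [hg, he, hf]; simp [modelMetric_apply]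
  · intro i j
    rw [hω, he, he]
    fin_cases i <;> fin_cases j <;> simp [modelMetric_apply, modelJ_apply, Fin.sum_univ_three]
  · intro i j
    rw [hω, he, hf]
    fin_cases i <;> fin_cases j <;> simp [modelMetric_apply, modelJ_apply, Fin.sum_univ_three]
  · intro i j
    rw [hω, hf, hf]
    fin_cases i <;> fin_cases j <;> simp [modelMetric_apply, modelJ_apply, Fin.sum_univ_three]
  · intro x y
    rw [hg]; simp [hφ, modelMetric_apply]
  · intro x hx
    rw [hg]
    have h0 : e.equivFun x ≠ 0 := fun h => hx ((map_eq_zero_iff _ e.equivFun.injective).mp h)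
    have := hpos _ h0
    simpa [hφ, modelMetric_apply] using this
  · intro x hx
    rw [hg]
    have h0 : f.equivFun x ≠ 0 := fun h => hx ((map_eq_zero_iff _ f.equivFun.injective).mp h)
    have := hpos _ h0
    simpa [hφ, modelMetric_apply] using this
  · exact congrArg QuadraticAlgebra.re hΨ
  · rw [neg_one_mul]
    exact congrArg QuadraticAlgebra.im hΨ

end Model

/-! ### Three-dimensional Lie algebras in a basis -/

section LieThree

variable {L : Type*} [LieRing L] [LieAlgebra ℝ L] {e : Module.Basis (Fin 3) ℝ L}
  {A : Fin 3 → Fin 3 → ℝ}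

theorem exists_hasStructure (e : Module.Basis (Fin 3) ℝ L) : ∃ A, HasStructure e A := by
  refine ⟨fun i j => - e.repr (![⁅e 1, e 2⁆, ⁅e 2, e 0⁆, ⁅e 0, e 1⁆] j) i, ?_⟩
  have h : ∀ x : L, x = -((- e.repr x 0) • e 0 + (- e.repr x 1) • e 1 + (- e.repr x 2) • e 2) := by
    intro x
    conv_lhs => rw [← e.sum_repr x, Fin.sum_univ_three]
    module
  exact ⟨h _, h _, h _⟩

theorem HasStructure.lie_eq (h : HasStructure e A) (x₀ x₁ x₂ y₀ y₁ y₂ : ℝ) :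
    ⁅x₀ • e 0 + x₁ • e 1 + x₂ • e 2, y₀ • e 0 + y₁ • e 1 + y₂ • e 2⁆ =
      -((A 0 0 * (x₁ * y₂ - x₂ * y₁) + A 0 1 * (x₂ * y₀ - x₀ * y₂) + A 0 2 * (x₀ * y₁ - x₁ * y₀)) • e 0 +
       (A 1 0 * (x₁ * y₂ - x₂ * y₁) + A 1 1 * (x₂ * y₀ - x₀ * y₂) + A 1 2 * (x₀ * y₁ - x₁ * y₀)) • e 1 +
       (A 2 0 * (x₁ * y₂ - x₂ * y₁) + A 2 1 * (x₂ * y₀ - x₀ * y₂) + A 2 2 * (x₀ * y₁ - x₁ * y₀)) • e 2) := by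
  obtain ⟨h12, h20, h01⟩ := h
  have h21 : ⁅e 2, e 1⁆ = A 0 0 • e 0 + A 1 0 • e 1 + A 2 0 • e 2 := by
    rw [← lie_skew, h12, neg_neg]
  have h02 : ⁅e 0, e 2⁆ = A 0 1 • e 0 + A 1 1 • e 1 + A 2 1 • e 2 := by
    rw [← lie_skew, h20, neg_neg]
  have h10 : ⁅e 1, e 0⁆ = A 0 2 • e 0 + A 1 2 • e 1 + A 2 2 • e 2 := by
    rw [← lie_skew, h01, neg_neg]
  simp only [add_lie, lie_add, smul_lie, lie_smul, lie_self, h12, h20, h01, h21, h02, h10]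
  module

theorem basis_expand (e : Module.Basis (Fin 3) ℝ L) (x : L) :
    ∃ x₀ x₁ x₂ : ℝ, x = x₀ • e 0 + x₁ • e 1 + x₂ • e 2 :=
  ⟨e.repr x 0, e.repr x 1, e.repr x 2, by
    conv_lhs => rw [← e.sum_repr x, Fin.sum_univ_three]⟩

theorem HasStructure.isLieAbelian_iff (h : HasStructure e A) :
    IsLieAbelian L ↔ ∀ i j, A i j = 0 := by
  constructor
  · intro hL
    obtain ⟨h0, h1, h2⟩ := h
    simp only [LieModule.IsTrivial.trivial, zero_eq_neg] at h0 h1 h2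
    have key : ∀ a b c : ℝ, a • e 0 + b • e 1 + c • e 2 = 0 → a = 0 ∧ b = 0 ∧ c = 0 := by
      intro a b c habc
      have := Fintype.linearIndependent_iff.mp e.linearIndependent ![a, b, c]
        (by simpa [Fin.sum_univ_three] using habc)
      exact ⟨this 0, this 1, this 2⟩
    obtain ⟨a1, a2, a3⟩ := key _ _ _ h0
    obtain ⟨b1, b2, b3⟩ := key _ _ _ h1
    obtain ⟨c1, c2, c3⟩ := key _ _ _ h2
    intro i j
    fin_cases i <;> fin_cases j <;> assumption
  · intro hA
    refine ⟨fun x y => ?_⟩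
    obtain ⟨x0, x1, x2, rfl⟩ := basis_expand e x
    obtain ⟨y0, y1, y2, rfl⟩ := basis_expand e y
    rw [h.lie_eq]
    simp [hA]

/-- The trace of `ad x` is `-∑ xᵢ · divergence A i`, so unimodularity is the symmetry of `A`. -/
theorem HasStructure.isUnimodularLie_iff (h : HasStructure e A) :
    IsUnimodularLie L ↔ ∀ j, divergence A j = 0 := by
  have htr : ∀ x, LinearMap.trace ℝ L (LieAlgebra.ad ℝ L x) = ∑ i, e.repr ⁅x, e i⁆ i := by
    intro x
    rw [LinearMap.trace_eq_matrix_trace ℝ e, Matrix.trace]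
    simp [LinearMap.toMatrix_apply]
  have hc : ∀ a b c : ℝ, ∀ i, e.repr (a • e 0 + b • e 1 + c • e 2) i = ![a, b, c] i := by
    intro a b c i
    fin_cases i <;> simp
  have hx : ∀ x₀ x₁ x₂ : ℝ,
      LinearMap.trace ℝ L (LieAlgebra.ad ℝ L (x₀ • e 0 + x₁ • e 1 + x₂ • e 2)) =
        -(x₀ * divergence A 0 + x₁ * divergence A 1 + x₂ * divergence A 2) := by
    intro x₀ x₁ x₂
    have l0 := h.lie_eq x₀ x₁ x₂ 1 0 0
    have l1 := h.lie_eq x₀ x₁ x₂ 0 1 0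
    have l2 := h.lie_eq x₀ x₁ x₂ 0 0 1
    simp only [one_smul, zero_smul, add_zero, zero_add] at l0 l1 l2
    rw [htr, Fin.sum_univ_three, l0, l1, l2]
    simp only [map_neg, Finsupp.neg_apply, hc, divergence, Matrix.cons_val]
    ring
  constructor
  · intro hL
    have h0 := hx 1 0 0
    have h1 := hx 0 1 0
    have h2 := hx 0 0 1
    rw [hL] at h0 h1 h2
    intro j
    fin_cases j
    · change divergence A 0 = 0; linarith
    · change divergence A 1 = 0; linarith
    · change divergence A 2 = 0; linarith
  · intro hA x
    obtain ⟨x0, x1, x2, rfl⟩ := basis_expand e x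
    rw [hx, hA, hA, hA]; simp

/-- A change of basis by an invertible matrix. -/
theorem exists_basis_of_det (e : Module.Basis (Fin 3) ℝ L) (P : Matrix (Fin 3) (Fin 3) ℝ)
    (hP : P.det ≠ 0) :
    ∃ b : Module.Basis (Fin 3) ℝ L, ∀ i, b i = P i 0 • e 0 + P i 1 • e 1 + P i 2 • e 2 := by
  have hu : IsUnit P.transpose.det := by
    rw [Matrix.det_transpose]; exact isUnit_iff_ne_zero.mpr hP
  refine ⟨e.map (Matrix.toLinearEquiv e P.transpose hu), fun i => ?_⟩
  rw [Module.Basis.map_apply, Matrix.toLinearEquiv_apply, Matrix.toLin_self, Fin.sum_univ_three]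
  rfl

theorem exists_scaled_basis (e : Module.Basis (Fin 3) ℝ L) {k₀ k₁ k₂ : ℝ} (h₀ : k₀ ≠ 0)
    (h₁ : k₁ ≠ 0) (h₂ : k₂ ≠ 0) :
    ∃ b : Module.Basis (Fin 3) ℝ L, b 0 = k₀ • e 0 ∧ b 1 = k₁ • e 1 ∧ b 2 = k₂ • e 2 := by
  obtain ⟨b, hb⟩ := exists_basis_of_det e !![k₀, 0, 0; 0, k₁, 0; 0, 0, k₂]
    (by simp [Matrix.det_fin_three, h₀, h₁, h₂])
  exact ⟨b, by simp [hb], by simp [hb], by simp [hb]⟩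

/-- Scaling the basis by `k` multiplies brackets by `k²` and basis vectors by `k`. Proportional
structure matrices thus define isomorphic algebras. -/
theorem HasStructure.exists_smul (h : HasStructure e A) {k : ℝ} (hk : k ≠ 0) :
    ∃ b : Module.Basis (Fin 3) ℝ L, HasStructure b fun i j => k * A i j := by
  obtain ⟨b, b0, b1, b2⟩ := exists_scaled_basis e hk hk hk
  refine ⟨b, ?_, ?_, ?_⟩ <;> simp only [b0, b1, b2, smul_lie, lie_smul]
  · rw [h.1]; module
  · rw [h.2.1]; module
  · rw [h.2.2]; module

theorem HasStructure.nonempty_lieEquiv {L' : Type*} [LieRing L'] [LieAlgebra ℝ L']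
    {f : Module.Basis (Fin 3) ℝ L'} (h : HasStructure e A) (h' : HasStructure f A) :
    Nonempty (L ≃ₗ⁅ℝ⁆ L') := by
  set φ : L ≃ₗ[ℝ] L' := e.equiv f (Equiv.refl _) with hφ
  have hφe : ∀ i, φ (e i) = f i := fun i => by simp [hφ]
  refine ⟨{ φ with map_lie' := ?_ }⟩
  intro x y
  change φ ⁅x, y⁆ = ⁅φ x, φ y⁆
  obtain ⟨x0, x1, x2, rfl⟩ := basis_expand e x
  obtain ⟨y0, y1, y2, rfl⟩ := basis_expand e y
  simp only [h.lie_eq, map_add, map_smul, map_neg, hφe, h'.lie_eq]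

theorem HasStructure.map {L' : Type*} [LieRing L'] [LieAlgebra ℝ L']
    (h : HasStructure e A) (φ : L ≃ₗ⁅ℝ⁆ L') :
    HasStructure (e.map φ.toLinearEquiv) A := by
  obtain ⟨h0, h1, h2⟩ := h
  refine ⟨?_, ?_, ?_⟩ <;>
    simp only [Module.Basis.map_apply, LieEquiv.coe_toLinearEquiv, ← LieEquiv.map_lie, h0, h1, h2,
      map_neg, map_add, map_smul]

end LieThree

/-! ### Diagonal structure constants -/

section DiagonalStructures

variable {L : Type*} [LieRing L] [LieAlgebra ℝ L]

variable (L) in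
/-- There is a basis with `de¹ = x e²³`, `de² = y e³¹`, `de³ = z e¹²`. -/
def HasDiagonalStructure (x y z : ℝ) : Prop :=
  ∃ b : Module.Basis (Fin 3) ℝ L, ⁅b 1, b 2⁆ = -(x • b 0) ∧ ⁅b 2, b 0⁆ = -(y • b 1) ∧
    ⁅b 0, b 1⁆ = -(z • b 2)

variable {x y z : ℝ}

/-- Only the signs of the diagonal entries matter: scaling the basis vectors by `√(qr)`, `√(rp)`,
`√(pq)` multiplies the entries by `p`, `q`, `r`. -/
theorem HasDiagonalStructure.rescale (h : HasDiagonalStructure L x y z) {p q r : ℝ} (hp : 0 < p)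
    (hq : 0 < q) (hr : 0 < r) : HasDiagonalStructure L (p * x) (q * y) (r * z) := by
  obtain ⟨e, h0, h1, h2⟩ := h
  obtain ⟨b, b0, b1, b2⟩ := exists_scaled_basis e (k₀ := √q * √r) (k₁ := √r * √p)
    (k₂ := √p * √q) (by positivity) (by positivity) (by positivity)
  have hp2 := Real.mul_self_sqrt hp.le
  have hq2 := Real.mul_self_sqrt hq.le
  have hr2 := Real.mul_self_sqrt hr.le
  refine ⟨b, ?_, ?_, ?_⟩ <;> simp only [b0, b1, b2, smul_lie, lie_smul, h0, h1, h2] <;>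
    match_scalars
  · linear_combination (-√r * √q * x) * hp2
  · linear_combination (-√r * √p * y) * hq2
  · linear_combination (-√p * √q * z) * hr2

theorem HasDiagonalStructure.neg (h : HasDiagonalStructure L x y z) :
    HasDiagonalStructure L (-x) (-y) (-z) := by
  obtain ⟨e, h0, h1, h2⟩ := h
  obtain ⟨b, b0, b1, b2⟩ := exists_scaled_basis e (k₀ := -1) (k₁ := -1) (k₂ := -1)
    (by norm_num) (by norm_num) (by norm_num)
  refine ⟨b, ?_, ?_, ?_⟩ <;> simp only [b0, b1, b2, smul_lie, lie_smul, h0, h1, h2] <;>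
    match_scalars <;> ring

theorem HasDiagonalStructure.cycle (h : HasDiagonalStructure L x y z) :
    HasDiagonalStructure L y z x := by
  obtain ⟨e, h0, h1, h2⟩ := h
  refine ⟨e.reindex (finRotate 3).symm, ?_, ?_, ?_⟩ <;> simpa

theorem isSu2_iff : IsSu2 L ↔ HasDiagonalStructure L 1 1 1 := by
  simp [IsSu2, HasDiagonalStructure]

theorem isSl2R_iff : IsSl2R L ↔ HasDiagonalStructure L 1 1 (-1) := by
  simp [IsSl2R, HasDiagonalStructure]

theorem isE2_iff : IsE2 L ↔ HasDiagonalStructure L 0 1 1 := by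
  simp [IsE2, HasDiagonalStructure]

theorem isR2PlusR_iff : IsR2PlusR L ↔ IsR3 L 0 := by
  simp only [IsR2PlusR, IsR3, zero_smul]
  refine exists_congr fun b => and_congr_right fun _ => and_congr_left fun _ => ?_
  rw [← lie_skew, neg_eq_zero]

/-- Since `1 + μ > 0`, the signs of `(1, μ, 1 + μ)` depend only on the sign of `μ`: positive gives
`su(2)`, zero gives `e(2)`, negative gives `sl(2,ℝ)`. This merges three entries of the list into one
family. -/
theorem isR3_and_hasDiagonalStructure_iff {L' : Type*} [LieRing L'] [LieAlgebra ℝ L'] :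
    (∃ μ : ℝ, -1 < μ ∧ μ ≤ 1 ∧ IsR3 L μ ∧ HasDiagonalStructure L' 1 μ (1 + μ)) ↔
      (IsE2 L' ∧ IsR2PlusR L) ∨ (IsSu2 L' ∧ ∃ μ : ℝ, 0 < μ ∧ μ ≤ 1 ∧ IsR3 L μ) ∨
      (IsSl2R L' ∧ ∃ μ : ℝ, -1 < μ ∧ μ < 0 ∧ IsR3 L μ) := by
  rw [isE2_iff, isR2PlusR_iff, isSu2_iff, isSl2R_iff]
  constructor
  · rintro ⟨μ, h1, h2, hL, hL'⟩
    have hp : 0 < 1 + μ := by linarith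
    rcases lt_trichotomy μ 0 with hμ | rfl | hμ
    · refine Or.inr (Or.inr ⟨?_, μ, h1, hμ, hL⟩)
      have := (hL'.rescale one_pos (inv_pos.mpr (neg_pos.mpr hμ)) (inv_pos.mpr hp)).cycle.cycle
      rw [mul_one, inv_mul_cancel₀ hp.ne', inv_neg, neg_mul, inv_mul_cancel₀ hμ.ne] at this
      exact this
    · refine Or.inl ⟨?_, hL⟩
      rw [add_zero] at hL'
      exact hL'.cycle
    · refine Or.inr (Or.inl ⟨?_, μ, hμ, h2, hL⟩)
      have := hL'.rescale one_pos (inv_pos.mpr hμ) (inv_pos.mpr hp)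
      rwa [mul_one, inv_mul_cancel₀ hp.ne', inv_mul_cancel₀ hμ.ne'] at this
  · rintro (⟨h, hL⟩ | ⟨h, μ, h1, h2, hL⟩ | ⟨h, μ, h1, h2, hL⟩)
    · refine ⟨0, by norm_num, by norm_num, hL, ?_⟩
      rw [add_zero]
      exact h.cycle.cycle
    · refine ⟨μ, by linarith, h2, hL, ?_⟩
      have := h.rescale one_pos h1 (show 0 < 1 + μ by linarith)
      rwa [mul_one, mul_one, mul_one] at this
    · refine ⟨μ, h1, by linarith, hL, ?_⟩
      have := h.cycle.rescale one_pos (neg_pos.mpr h2) (show 0 < 1 + μ by linarith)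
      rwa [mul_one, mul_one, neg_mul_neg, mul_one] at this

end DiagonalStructures

/-! ### Solving the half-flat equations -/

section HalfFlatAlgebra

namespace SL3RStructure

variable {a c s t : ℝ} {A B : Fin 3 → Fin 3 → ℝ}

/-- Exchanging the summands exchanges `s` with `t` and reverses `a`, so cases distinguished by the
summand need only one treatment. -/
theorem HalfFlatEqs.swap (h : HalfFlatEqs a c s t A B) : HalfFlatEqs (-a) c t s B A := by
  obtain ⟨h1, h2, h3, h4, h5, h6, h7, h8, h9, h10, h11, h12, h13, h14, h15, h16, h17, h18, h19,
      h20, h21⟩ := h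
  constructor <;> linarith

/-- At `a = 0` the `w` and `z` equations are exactly the vanishing of the divergences. The `m`
equations involve the transpose of `A`, which equals `A` once its divergence is zero. -/
theorem HalfFlatEqs.typeI_iff :
    HalfFlatEqs 0 1 s t A B ↔ (∀ j, divergence A j = 0) ∧ (∀ j, divergence B j = 0) ∧
      ∀ j k, t * B j k + s * A j k = 0 := by
  constructor
  · rintro ⟨-, -, -, -, -, -, m0, m1, m2, m3, m4, m5, m6, m7, m8, w0, w1, w2, z0, z1, z2⟩
    have hA : ∀ j, divergence A j = 0 := by
      intro j; fin_cases j <;> simp <;> linarith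
    have hB : ∀ j, divergence B j = 0 := by
      intro j; fin_cases j <;> simp <;> linarith
    refine ⟨hA, hB, ?_⟩
    have a0 := hA 0
    have a1 := hA 1
    have a2 := hA 2
    simp only [divergence, Matrix.cons_val] at a0 a1 a2
    intro j k
    fin_cases j <;> fin_cases k <;> simp only [Fin.zero_eta, Fin.mk_one, Fin.reduceFinMk]
    · linear_combination m0
    · linear_combination m1 + s * a2
    · linear_combination m2 - s * a1
    · linear_combination m3 - s * a2
    · linear_combination m4
    · linear_combination m5 + s * a0
    · linear_combination m6 + s * a1
    · linear_combination m7 - s * a0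
    · linear_combination m8
  · rintro ⟨hA, hB, hAB⟩
    have a0 := hA 0
    have a1 := hA 1
    have a2 := hA 2
    simp only [divergence, Matrix.cons_val] at a0 a1 a2
    constructor <;> (try rw [hA]) <;> (try rw [hA]) <;> (try rw [hB]) <;> (try rw [hB]) <;> (try ring1)
    · linear_combination hAB 0 0
    · linear_combination hAB 0 1 - s * a2
    · linear_combination hAB 0 2 + s * a1
    · linear_combination hAB 1 0 + s * a2
    · linear_combination hAB 1 1
    · linear_combination hAB 1 2 - s * a0
    · linear_combination hAB 2 0 - s * a1
    · linear_combination hAB 2 1 + s * a0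
    · linear_combination hAB 2 2

/-- The `r` and `l` equations are 2×2 systems for the first two divergences with determinants `t² +
s²a²` and `s² + t²a²`, non-zero because `a ≠ 0` and `s, t` are not both zero. With these divergences
gone, `w0`, `w1`, `z0`, `z1` kill the third rows off the diagonal, and symmetry kills the third
columns. -/
theorem HalfFlatEqs.blocks (h : HalfFlatEqs a c s t A B) (ha : a ≠ 0) (hst : s ^ 2 ≠ t ^ 2) :
    (A 0 2 = 0 ∧ A 1 2 = 0 ∧ A 2 0 = 0 ∧ A 2 1 = 0) ∧
    (B 0 2 = 0 ∧ B 1 2 = 0 ∧ B 2 0 = 0 ∧ B 2 1 = 0) := by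
  have hs : t ^ 2 + s ^ 2 * a ^ 2 ≠ 0 := by
    intro h0
    have h1 : t = 0 := by
      have : t ^ 2 ≤ 0 := by nlinarith [sq_nonneg (s * a)]
      exact pow_eq_zero_iff (two_ne_zero) |>.mp (le_antisymm this (sq_nonneg t))
    subst h1
    have : s = 0 := by simpa [ha] using h0
    subst this
    exact hst rfl
  have hs' : s ^ 2 + t ^ 2 * a ^ 2 ≠ 0 := by
    intro h0
    have h1 : s = 0 := by
      have : s ^ 2 ≤ 0 := by nlinarith [sq_nonneg (t * a)]
      exact pow_eq_zero_iff (two_ne_zero) |>.mp (le_antisymm this (sq_nonneg s))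
    subst h1
    have : t = 0 := by simpa [ha] using h0
    subst this
    exact hst rfl
  have u0 : divergence A 0 = 0 := (mul_eq_zero.mp (show (t ^ 2 + s ^ 2 * a ^ 2) * _ = 0 by
    linear_combination t * h.r1 - s * a * h.r2)).resolve_left hs
  have u1 : divergence A 1 = 0 := (mul_eq_zero.mp (show (t ^ 2 + s ^ 2 * a ^ 2) * _ = 0 by
    linear_combination s * a * h.r1 + t * h.r2)).resolve_left hs
  have v0 : divergence B 0 = 0 := (mul_eq_zero.mp (show (s ^ 2 + t ^ 2 * a ^ 2) * _ = 0 by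
    linear_combination s * h.l1 + t * a * h.l2)).resolve_left hs'
  have v1 : divergence B 1 = 0 := (mul_eq_zero.mp (show (s ^ 2 + t ^ 2 * a ^ 2) * _ = 0 by
    linear_combination s * h.l2 - t * a * h.l1)).resolve_left hs'
  have w0 := h.w0
  have w1 := h.w1
  have z0 := h.z0
  have z1 := h.z1
  rw [u0, mul_zero, zero_add, mul_eq_zero, or_iff_right ha] at w0
  rw [u1, mul_zero, zero_add, mul_eq_zero, or_iff_right ha] at w1
  rw [v0, mul_zero, zero_sub, neg_eq_zero, mul_eq_zero, or_iff_right ha] at z0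
  rw [v1, mul_zero, zero_sub, neg_eq_zero, mul_eq_zero, or_iff_right ha] at z1
  simp only [divergence, Matrix.cons_val] at u0 u1 v0 v1
  refine ⟨⟨?_, ?_, z0, z1⟩, ?_, ?_, w0, w1⟩ <;> linarith

theorem eq_block {M : Fin 3 → Fin 3 → ℝ}
    (h : M 0 2 = 0 ∧ M 1 2 = 0 ∧ M 2 0 = 0 ∧ M 2 1 = 0) :
    M = !![M 0 0, M 0 1, 0; M 1 0, M 1 1, 0; 0, 0, M 2 2] := by
  obtain ⟨h1, h2, h3, h4⟩ := h
  ext i j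
  fin_cases i <;> fin_cases j <;> simp [h1, h2, h3, h4]

/-- Here `r3` forces `t = 0`, hence `s ≠ 0`, and `l3` makes `B` symmetric. The `m` equations express
the block of `A` as `a` times the block of `B` followed by a quarter turn, and `w2` identifies `B 2
2` with the trace of that block. -/
theorem HalfFlatEqs.of_divergence_ne_zero (h : HalfFlatEqs a c s t A B) (ha : a ≠ 0) (hc : c ≠ 0)
    (hst : s ^ 2 ≠ t ^ 2) (hu : divergence A 2 ≠ 0) :
    ∃ x y z, x + z ≠ 0 ∧ A = !![a * y, a * -x, 0; a * z, a * -y, 0; 0, 0, 0] ∧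
      B = !![x, y, 0; y, z, 0; 0, 0, x + z] := by
  obtain ⟨hA, hB⟩ := h.blocks ha hst
  have ht : t = 0 := by simpa [hc, hu] using h.r3
  subst ht
  have hs : s ≠ 0 := by rintro rfl; exact hst rfl
  have v2 : divergence B 2 = 0 := by simpa [hc, hs] using h.l3
  have a22 : A 2 2 = 0 := by simpa [v2, ha] using h.z2
  have e0 : A 0 0 = a * B 1 0 := mul_left_cancel₀ hs (by linear_combination h.m00)
  have e1 : A 1 0 = a * B 1 1 := mul_left_cancel₀ hs (by linear_combination h.m01)
  have e2 : A 0 1 = a * -B 0 0 := mul_left_cancel₀ hs (by linear_combination h.m10)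
  have e3 : A 1 1 = a * -B 0 1 := mul_left_cancel₀ hs (by linear_combination h.m11)
  have w2 := h.w2
  simp only [divergence, Matrix.cons_val] at hu v2 w2
  have b10 : B 1 0 = B 0 1 := by linarith
  have b22 : B 2 2 = B 0 0 + B 1 1 := mul_left_cancel₀ ha (by rw [e1, e2] at w2; linarith)
  refine ⟨B 0 0, B 0 1, B 1 1, ?_, ?_, ?_⟩
  · intro h0
    apply hu
    rw [e1, e2]
    linear_combination (-a) * h0
  · rw [eq_block hA, a22, e0, e1, e2, e3, b10]
  · conv_lhs => rw [eq_block hB, b10, b22]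

/-- With both matrices symmetric, the block traces satisfy a homogeneous system of determinant `±(s²
- t²)`, so they vanish. -/
theorem HalfFlatEqs.of_divergence_eq_zero (h : HalfFlatEqs a c s t A B) (ha : a ≠ 0)
    (hst : s ^ 2 ≠ t ^ 2) (hu : divergence A 2 = 0) (hv : divergence B 2 = 0) :
    ∃ p q p' q', A = !![p, q, 0; q, -p, 0; 0, 0, 0] ∧ B = !![p', q', 0; q', -p', 0; 0, 0, 0] ∧
      ((p = 0 ∧ q = 0) ↔ (p' = 0 ∧ q' = 0)) := by
  obtain ⟨hA, hB⟩ := h.blocks ha hst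
  have a22 : A 2 2 = 0 := by simpa [hv, ha] using h.z2
  have b22 : B 2 2 = 0 := by simpa [hu, ha] using h.w2
  simp only [divergence, Matrix.cons_val] at hu hv
  have hst' : s ^ 2 - t ^ 2 ≠ 0 := sub_ne_zero.mpr hst
  obtain ⟨-, -, -, -, -, -, m0, m1, -, m3, m4, -⟩ := h
  have e1 : t * (B 0 0 + B 1 1) + s * (A 0 0 + A 1 1) = 0 := by
    linear_combination m0 + m4 - s * a * hv + t * a * hu
  have e2 : s * (B 0 0 + B 1 1) + t * (A 0 0 + A 1 1) = 0 :=
    mul_left_cancel₀ ha (by linear_combination m3 - m1 + t * hv - s * hu)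
  have trA : A 0 0 + A 1 1 = 0 := (mul_eq_zero.mp (show (s ^ 2 - t ^ 2) * _ = 0 by
    linear_combination s * e1 - t * e2)).resolve_left hst'
  have trB : B 0 0 + B 1 1 = 0 := (mul_eq_zero.mp (show (s ^ 2 - t ^ 2) * _ = 0 by
    linear_combination s * e2 - t * e1)).resolve_left hst'
  have a10 : A 1 0 = A 0 1 := by linarith
  have b10 : B 1 0 = B 0 1 := by linarith
  have a11 : A 1 1 = - A 0 0 := by linarith
  have b11 : B 1 1 = - B 0 0 := by linarith
  rw [a10, b10] at m0
  rw [a10, b11] at m1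
  -- The equations `m0`, `m1` are linear in `(p, q)` and in `(p', q')`, with these two numbers as
  -- the determinants; so each pair determines the other.
  have hs : t ^ 2 + s ^ 2 * a ^ 2 ≠ 0 ∧ s ^ 2 + t ^ 2 * a ^ 2 ≠ 0 := by
    have h1 : 0 < a ^ 2 := by positivity
    rcases eq_or_ne s 0 with rfl | hs
    · have : t ≠ 0 := by rintro rfl; exact hst rfl
      constructor <;> positivity
    · constructor <;> positivity
  refine ⟨A 0 0, A 0 1, B 0 0, B 0 1, ?_, ?_, ?_, ?_⟩
  · conv_lhs => rw [eq_block hA, a10, a11, a22]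
  · conv_lhs => rw [eq_block hB, b10, b11, b22]
  · rintro ⟨h1, h2⟩
    rw [h1, h2] at m0 m1
    exact ⟨(mul_eq_zero.mp (show (t ^ 2 + s ^ 2 * a ^ 2) * _ = 0 by
      linear_combination t * m0 + s * a * m1)).resolve_left hs.1,
      (mul_eq_zero.mp (show (t ^ 2 + s ^ 2 * a ^ 2) * _ = 0 by
      linear_combination t * m1 - s * a * m0)).resolve_left hs.1⟩
  · rintro ⟨h1, h2⟩
    rw [h1, h2] at m0 m1
    exact ⟨(mul_eq_zero.mp (show (s ^ 2 + t ^ 2 * a ^ 2) * _ = 0 by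
      linear_combination s * m0 - t * a * m1)).resolve_left hs.2,
      (mul_eq_zero.mp (show (s ^ 2 + t ^ 2 * a ^ 2) * _ = 0 by
      linear_combination s * m1 + t * a * m0)).resolve_left hs.2⟩

end SL3RStructure

end HalfFlatAlgebra

/-! ### Recognising the algebras from their structure constants -/

section Recognition

variable {L L' : Type*} [LieRing L] [LieAlgebra ℝ L] [LieRing L'] [LieAlgebra ℝ L']
  {e : Module.Basis (Fin 3) ℝ L} {f : Module.Basis (Fin 3) ℝ L'}

/-- On the abelian ideal spanned by `e 0`, `e 1`, the square of `ad (e 2)` is `p² + q²`. After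
normalisation it is a trace-free involution, which exchanges a vector with its image. -/
theorem isE11_of_hasStructure {p q : ℝ} (h : HasStructure e !![p, q, 0; q, -p, 0; 0, 0, 0])
    (hpq : ¬ (p = 0 ∧ q = 0)) : IsE11 L := by
  obtain ⟨h12, h20, h01⟩ := h
  simp at h12 h20 h01
  have h21 : ⁅e 2, e 1⁆ = p • e 0 + q • e 1 := by rw [← lie_skew, h12]; abel
  have h10 : ⁅e 1, e 0⁆ = 0 := by rw [← lie_skew, h01, neg_zero]
  have h02 : ⁅e 0, e 2⁆ = q • e 0 - p • e 1 := by rw [← lie_skew, h20]; abel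
  -- The vector `e 0` can serve as `b 1` unless it is an eigenvector, that is, unless `p = 0`; then
  -- `e 0 + e 1` is used. In both cases `b 2` is the image of `b 1` under `ad (b 0)`.
  by_cases hp : p = 0
  · have hq : q ≠ 0 := fun h => hpq ⟨hp, h⟩
    subst hp
    obtain ⟨b, hb⟩ := exists_basis_of_det e !![0, 0, q⁻¹; 1, 1, 0; -1, 1, 0]
      (by simp [Matrix.det_fin_three, hq])
    have b0 := hb 0
    have b1 := hb 1
    have b2 := hb 2
    simp at b0 b1 b2
    refine ⟨b, ?_, ?_, ?_⟩ <;>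
      simp only [b0, b1, b2, add_lie, lie_add, neg_lie, lie_neg, smul_lie, lie_smul, lie_self,
        h01, h10]
    · simp
    · rw [h12, h02]; match_scalars <;> field_simp <;> ring
    · rw [h20, h21]; match_scalars <;> field_simp <;> ring
  · have hr : p ^ 2 + q ^ 2 ≠ 0 := by positivity
    have hr' : √(p ^ 2 + q ^ 2) ≠ 0 := by positivity
    have hr2 : √(p ^ 2 + q ^ 2) ^ 2 = p ^ 2 + q ^ 2 := Real.sq_sqrt (by positivity)
    generalize √(p ^ 2 + q ^ 2) = r at *
    obtain ⟨b, hb⟩ := exists_basis_of_det e !![0, 0, r⁻¹; 1, 0, 0; -q / r, p / r, 0]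
      (by simp [Matrix.det_fin_three, hp, hr'])
    have b0 := hb 0
    have b1 := hb 1
    have b2 := hb 2
    simp at b0 b1 b2
    refine ⟨b, ?_, ?_, ?_⟩ <;>
      simp only [b0, b1, b2, add_lie, lie_add, smul_lie, lie_smul, lie_self, h01]
    · simp
    · rw [h12, h02]
      match_scalars <;> field_simp <;> linarith
    · rw [h20]; match_scalars <;> field_simp

/-- A symmetric two-by-two matrix of non-zero trace has an orthogonal pair of eigenvectors,
the eigenvalue of the first being the larger one in absolute value. -/
theorem exists_eigenvectors {x y z : ℝ} (h : x + z ≠ 0) :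
    ∃ α β l m : ℝ, 0 < α ^ 2 + β ^ 2 ∧ l + m = x + z ∧ m ^ 2 ≤ l ^ 2 ∧
      x * α + y * β = l * α ∧ y * α + z * β = l * β ∧
      y * α - x * β = -(m * β) ∧ z * α - y * β = m * α := by
  by_cases hy : y = 0
  · subst hy
    rcases le_total (z ^ 2) (x ^ 2) with hxz | hxz
    · exact ⟨1, 0, x, z, by norm_num, rfl, hxz, by ring, by ring, by ring, by ring⟩
    · exact ⟨0, 1, z, x, by norm_num, by ring, hxz, by ring, by ring, by ring, by ring⟩
  -- The square root of the discriminant is given the sign of `x + z`, so that `l² - m² = (x + z) D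
  -- ≥ 0`.
  · obtain ⟨D, hD0, hD⟩ : ∃ D : ℝ, 0 ≤ (x + z) * D ∧ D ^ 2 = (x - z) ^ 2 + 4 * y ^ 2 := by
      have hsq : √((x - z) ^ 2 + 4 * y ^ 2) ^ 2 = (x - z) ^ 2 + 4 * y ^ 2 :=
        Real.sq_sqrt (by positivity)
      rcases le_total 0 (x + z) with h0 | h0
      · exact ⟨√((x - z) ^ 2 + 4 * y ^ 2), by positivity, hsq⟩
      · refine ⟨-√((x - z) ^ 2 + 4 * y ^ 2), ?_, by rw [neg_sq, hsq]⟩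
        exact mul_nonneg_of_nonpos_of_nonpos h0 (neg_nonpos.mpr (Real.sqrt_nonneg _))
    refine ⟨y, (x + z + D) / 2 - x, (x + z + D) / 2, (x + z - D) / 2, by positivity, by ring, ?_,
      by ring, ?_, ?_, ?_⟩
    · nlinarith
    · linear_combination (-1 / 4) * hD
    · linear_combination (-1 / 4) * hD
    · ring

/-- On the span of `e 0`, `e 1`, `ad (e 2)` is `k` times the symmetric block of the other algebra,
so one orthogonal pair of eigenvectors normalises both. The ratio `μ = m / l` has `|μ| ≤ 1` by the
ordering of the eigenvalues, and `μ ≠ -1` because the trace is non-zero. -/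
theorem exists_isR3_of_hasStructure {k x y z : ℝ} (hk : k ≠ 0) (hxz : x + z ≠ 0)
    (h : HasStructure e !![k * y, k * -x, 0; k * z, k * -y, 0; 0, 0, 0])
    (h' : HasStructure f !![x, y, 0; y, z, 0; 0, 0, x + z]) :
    ∃ μ : ℝ, -1 < μ ∧ μ ≤ 1 ∧ IsR3 L μ ∧ HasDiagonalStructure L' 1 μ (1 + μ) := by
  obtain ⟨α, β, l, m, hN, hlm, hml, q1, q2, q3, q4⟩ := exists_eigenvectors (y := y) hxz
  have hl : l ≠ 0 := by
    rintro rfl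
    have : m = 0 := by
      have : m ^ 2 ≤ 0 := by simpa using hml
      exact pow_eq_zero_iff two_ne_zero |>.mp (le_antisymm this (sq_nonneg m))
    subst this
    exact hxz (by linarith)
  have hlm' : 1 + m / l ≠ 0 := by
    intro h0
    apply hxz
    rw [← hlm]
    field_simp at h0
    linarith
  have hμ : (m / l) ^ 2 ≤ 1 := by
    rw [div_pow, div_le_one (by positivity)]; exact hml
  have hμ1 := abs_le.mp ((sq_le_one_iff_abs_le_one _).mp hμ)
  obtain ⟨h12, h20, h01⟩ := h
  obtain ⟨k12, k20, k01⟩ := h'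
  simp at h12 h20 h01 k12 k20 k01
  refine ⟨m / l, lt_of_le_of_ne hμ1.1 fun h0 => hlm' (by rw [← h0]; ring), hμ1.2, ?_, ?_⟩
  · obtain ⟨b, hb⟩ := exists_basis_of_det e !![0, 0, (k * l)⁻¹; α, β, 0; -β, α, 0] (by
      rw [show Matrix.det !![0, 0, (k * l)⁻¹; α, β, 0; -β, α, 0] = (k * l)⁻¹ * (α ^ 2 + β ^ 2) by
        simp [Matrix.det_fin_three]; ring]
      positivity)
    have b0 := hb 0
    have b1 := hb 1
    have b2 := hb 2
    simp at b0 b1 b2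
    have h21 : ⁅e 2, e 1⁆ = (k * y) • e 0 + (k * z) • e 1 := by rw [← lie_skew, h12]; abel
    have h10 : ⁅e 1, e 0⁆ = 0 := by rw [← lie_skew, h01, neg_zero]
    refine ⟨b, ?_, ?_, ?_⟩ <;>
      simp only [b0, b1, b2, add_lie, lie_add, lie_neg, smul_lie, lie_smul, lie_self,
        h01, h10]
    · simp
    · rw [h20, h21]
      match_scalars <;> field_simp <;> linarith
    · rw [h20, h21]
      match_scalars <;> field_simp <;> linarith
  · have hd : HasDiagonalStructure L' l m ((α ^ 2 + β ^ 2) * (l + m)) := by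
      obtain ⟨b, hb⟩ := exists_basis_of_det f !![α, β, 0; -β, α, 0; 0, 0, 1] (by
        simp [Matrix.det_fin_three]
        nlinarith)
      have b0 := hb 0
      have b1 := hb 1
      have b2 := hb 2
      simp at b0 b1 b2
      have k21 : ⁅f 2, f 1⁆ = x • f 0 + y • f 1 := by rw [← lie_skew, k12]; abel
      have k02 : ⁅f 0, f 2⁆ = y • f 0 + z • f 1 := by rw [← lie_skew, k20]; abel
      have k10 : ⁅f 1, f 0⁆ = (x + z) • f 2 := by rw [← lie_skew, k01, neg_neg]
      refine ⟨b, ?_, ?_, ?_⟩ <;>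
        simp only [b0, b1, b2, add_lie, lie_add, neg_lie, lie_neg, smul_lie, lie_smul, lie_self,
          k01, k10, k12, k21, k02, k20]
      · match_scalars <;> linarith
      · match_scalars <;> linarith
      · match_scalars <;> first | ring1 | linear_combination (α ^ 2 + β ^ 2) * hlm
    have hN' := hN.ne'
    -- Rescaling allows positive factors only, so for `l < 0` all signs are first reversed by
    -- negating the basis.
    rcases hl.lt_or_gt with hl0 | hl0
    · have hl1 : 0 < -l := neg_pos.mpr hl0
      have := hd.neg.rescale (inv_pos.mpr hl1) (inv_pos.mpr hl1)
        (inv_pos.mpr (mul_pos hN hl1))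
      convert this using 1 <;> field_simp
    · have := hd.rescale (inv_pos.mpr hl0) (inv_pos.mpr hl0) (inv_pos.mpr (mul_pos hN hl0))
      convert this using 1 <;> field_simp

end Recognition

/-! ### The two classifications -/

section Classification

variable {L₁ L₂ : Type*} [LieRing L₁] [LieAlgebra ℝ L₁] [LieRing L₂] [LieAlgebra ℝ L₂]

namespace SL3RStructure

/-- Geometry ends here: with `s, t` read off from `Ψ(e₁,e₂,e₃)` one way, and the model pulled back
along bases the other way, existence is solvability of a linear system in the structure constants.
-/
theorem exists_hasNormalForm_iff (a : ℝ) :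
    (∃ S : SL3RStructure (L₁ × L₂),
      S.IsHalfFlat ∧ S.SummandsOrthogonal ∧ S.SummandsDefinite ∧ S.HasNormalForm a) ↔
    ∃ (e : Module.Basis (Fin 3) ℝ L₁) (f : Module.Basis (Fin 3) ℝ L₂) (s t : ℝ)
      (A B : Fin 3 → Fin 3 → ℝ), s ^ 2 ≠ t ^ 2 ∧ HasStructure e A ∧ HasStructure f B ∧
      HalfFlatEqs a √(1 + a ^ 2) s t A B := by
  have hc : √(1 + a ^ 2) ≠ 0 := by positivity
  constructor
  · rintro ⟨S, hflat, -, -, σ, e, f, h⟩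
    replace h : S.IsNormalPair a σ e f := h
    have hσ2 : σ * σ = 1 := by rcases h.1 with rfl | rfl <;> norm_num
    obtain ⟨A, hA⟩ := exists_hasStructure e
    obtain ⟨B, hB⟩ := exists_hasStructure f
    have hs : S.rePart ![(e 0, 0), (e 1, 0), (e 2, 0)] = √(1 + a ^ 2) *
        (S.rePart ![(e 0, 0), (e 1, 0), (e 2, 0)] / √(1 + a ^ 2)) := by field_simp
    have ht : S.imPart ![(e 0, 0), (e 1, 0), (e 2, 0)] = -σ * √(1 + a ^ 2) *
        (-σ * S.imPart ![(e 0, 0), (e 1, 0), (e 2, 0)] / √(1 + a ^ 2)) := by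
      field_simp; linear_combination (-S.imPart ![(e 0, 0), (e 1, 0), (e 2, 0)]) * hσ2
    refine ⟨e, f, _, _, A, B, ?_, hA, hB, (h.isHalfFlat_iff hs ht hA hB).mp hflat⟩
    intro h0
    apply h.norm_ne_zero
    rw [QuadraticAlgebra.norm_def]
    change S.rePart ![(e 0, 0), (e 1, 0), (e 2, 0)] * S.rePart ![(e 0, 0), (e 1, 0), (e 2, 0)] +
      0 * _ * _ - 1 * S.imPart ![(e 0, 0), (e 1, 0), (e 2, 0)] *
        S.imPart ![(e 0, 0), (e 1, 0), (e 2, 0)] = 0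
    rw [div_pow, div_pow, div_left_inj' (pow_ne_zero 2 hc)] at h0
    linear_combination h0 + S.imPart ![(e 0, 0), (e 1, 0), (e 2, 0)] ^ 2 * hσ2
  · rintro ⟨e, f, s, t, A, B, hst, hA, hB, hE⟩
    obtain ⟨S, h, ho, hd, hs, ht⟩ := exists_isNormalPair e f a hst
    exact ⟨S, (h.isHalfFlat_iff hs ht hA hB).mpr hE, ho, hd, 1, e, f, h⟩

theorem exists_typeI_iff (h₁ : Module.finrank ℝ L₁ = 3) (h₂ : Module.finrank ℝ L₂ = 3) :
    (∃ S : SL3RStructure (L₁ × L₂),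
        S.IsHalfFlat ∧ S.SummandsOrthogonal ∧ S.SummandsDefinite ∧ S.IsTypeI) ↔
      (Nonempty (L₁ ≃ₗ⁅ℝ⁆ L₂) ∧ IsUnimodularLie L₁ ∧ IsUnimodularLie L₂) ∨
      (¬ IsLieAbelian L₁ ∧ IsUnimodularLie L₁ ∧ IsLieAbelian L₂) ∨
      (IsLieAbelian L₁ ∧ ¬ IsLieAbelian L₂ ∧ IsUnimodularLie L₂) := by
  have hc : √(1 + (0 : ℝ) ^ 2) = 1 := by norm_num
  simp only [IsTypeI, exists_hasNormalForm_iff, hc, HalfFlatEqs.typeI_iff]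
  constructor
  · rintro ⟨e, f, s, t, A, B, hst, hA, hB, hA0, hB0, hAB⟩
    have uA := hA.isUnimodularLie_iff.mpr hA0
    have uB := hB.isUnimodularLie_iff.mpr hB0
    by_cases a1 : IsLieAbelian L₁ <;> by_cases a2 : IsLieAbelian L₂
    · refine Or.inl ⟨?_, uA, uB⟩
      have hBA : B = A := by
        ext i j; rw [hA.isLieAbelian_iff.mp a1, hB.isLieAbelian_iff.mp a2]
      exact hA.nonempty_lieEquiv (hBA ▸ hB)
    · exact Or.inr (Or.inr ⟨a1, a2, uB⟩)
    · exact Or.inr (Or.inl ⟨a1, uA, a2⟩)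
    · refine Or.inl ⟨?_, uA, uB⟩
      have ht : t ≠ 0 := by
        rintro rfl
        have hs : s ≠ 0 := by rintro rfl; exact hst rfl
        exact a1 (hA.isLieAbelian_iff.mpr fun j k => by simpa [hs] using hAB j k)
      have hs : s ≠ 0 := by
        rintro rfl
        exact a2 (hB.isLieAbelian_iff.mpr fun j k => by simpa [ht] using hAB j k)
      obtain ⟨b, hb⟩ := hA.exists_smul (k := -(s / t)) (neg_ne_zero.mpr (div_ne_zero hs ht))
      refine hb.nonempty_lieEquiv (f := f) ?_
      convert hB using 3 with i j
      field_simp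
      linear_combination - hAB i j
  · have : Module.Finite ℝ L₁ := Module.finite_of_finrank_pos (by omega)
    have : Module.Finite ℝ L₂ := Module.finite_of_finrank_pos (by omega)
    set e := Module.finBasisOfFinrankEq ℝ L₁ h₁
    set f := Module.finBasisOfFinrankEq ℝ L₂ h₂
    obtain ⟨A, hA⟩ := exists_hasStructure e
    obtain ⟨B, hB⟩ := exists_hasStructure f
    rintro (⟨⟨φ⟩, uA, uB⟩ | ⟨-, uA, a2⟩ | ⟨a1, -, uB⟩)
    -- The basis is scaled by 2 because equal matrices would force `s = -t`, a null `Ψ`; now `s =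
    -- -2`, `t = 1`.
    · obtain ⟨b, hb⟩ := (hA.map φ).exists_smul (k := 2) two_ne_zero
      exact ⟨e, b, -2, 1, A, _, by norm_num, hA, hb, hA.isUnimodularLie_iff.mp uA,
        hb.isUnimodularLie_iff.mp uB, fun j k => by ring⟩
    · have hB0 := hB.isLieAbelian_iff.mp a2
      refine ⟨e, f, 0, 1, A, B, by norm_num, hA, hB, hA.isUnimodularLie_iff.mp uA, ?_,
        fun j k => by rw [hB0]; ring⟩
      intro j; fin_cases j <;> simp [divergence, hB0]
    · have hA0 := hA.isLieAbelian_iff.mp a1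
      refine ⟨e, f, 1, 0, A, B, by norm_num, hA, hB, ?_, hB.isUnimodularLie_iff.mp uB,
        fun j k => by rw [hA0]; ring⟩
      intro j; fin_cases j <;> simp [divergence, hA0]

theorem inTypeIIList_iff : InTypeIIList L₁ L₂ ↔ (IsE11 L₁ ∧ IsE11 L₂) ∨
    ∃ μ : ℝ, -1 < μ ∧ μ ≤ 1 ∧ IsR3 L₂ μ ∧ HasDiagonalStructure L₁ 1 μ (1 + μ) := by
  rw [isR3_and_hasDiagonalStructure_iff, InTypeIIList]

/-- Structure constants of `r_{3,μ}` and of the algebra with `de¹ = e²³`, `de² = μ e³¹`,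
`de³ = (1 + μ) e¹²` that solve the half-flat equations. -/
theorem exists_halfFlatEqs_of_isR3 {μ : ℝ} (h₁ : IsR3 L₁ μ)
    (h₂ : HasDiagonalStructure L₂ 1 μ (1 + μ)) :
    ∃ (e : Module.Basis (Fin 3) ℝ L₁) (f : Module.Basis (Fin 3) ℝ L₂)
      (A B : Fin 3 → Fin 3 → ℝ), HasStructure e A ∧ HasStructure f B ∧
      ∀ c, HalfFlatEqs 1 c 1 0 A B := by
  obtain ⟨b, b12, b02, b01⟩ := h₁
  obtain ⟨f, f12, f20, f01⟩ := h₂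
  obtain ⟨e, he⟩ := exists_basis_of_det b !![0, 1, 0; 0, 0, 1; 1, 0, 0]
    (by simp [Matrix.det_fin_three])
  have e0 := he 0
  have e1 := he 1
  have e2 := he 2
  simp at e0 e1 e2
  -- These are the matrices of `HalfFlatEqs.of_divergence_ne_zero` with `a = 1` and `x = 1, y = 0, z
  -- = μ`.
  refine ⟨e, f, !![0, -1, 0; μ, 0, 0; 0, 0, 0], !![1, 0, 0; 0, μ, 0; 0, 0, 1 + μ],
    ⟨?_, ?_, ?_⟩, ⟨?_, ?_, ?_⟩, ?_⟩
  · rw [e1, e2, ← lie_skew, b02]; simp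
  · rw [e0, e2, b01]; simp
  · rw [e0, e1, b12]; simp
  · rw [f12]; simp
  · rw [f20]; simp
  · rw [f01]; simp
  · intro c
    constructor <;> simp [divergence]

/-- The matrices are those of the `r_{3,μ}` family continued to `μ = -1`, where the trace vanishes;
`e 0` and `e 1` are the eigenvectors `b 1 ± b 2` of `ad (b 0)`. -/
theorem exists_halfFlatEqs_of_isE11 (h₁ : IsE11 L₁) (h₂ : IsE11 L₂) :
    ∃ (e : Module.Basis (Fin 3) ℝ L₁) (f : Module.Basis (Fin 3) ℝ L₂)
      (A B : Fin 3 → Fin 3 → ℝ), HasStructure e A ∧ HasStructure f B ∧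
      ∀ c, HalfFlatEqs 1 c 1 0 A B := by
  obtain ⟨b, b12, b20, b01⟩ := h₁
  obtain ⟨d, d12, d20, d01⟩ := h₂
  obtain ⟨e, he⟩ := exists_basis_of_det b !![0, 1, 1; 0, 1, -1; 1, 0, 0]
    (by simp [Matrix.det_fin_three]; norm_num)
  obtain ⟨f, hf⟩ := exists_basis_of_det d !![0, 1, 0; 0, 0, 1; 1, 0, 0]
    (by simp [Matrix.det_fin_three])
  have e0 := he 0
  have e1 := he 1
  have e2 := he 2
  have f0 := hf 0
  have f1 := hf 1
  have f2 := hf 2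
  simp at e0 e1 e2 f0 f1 f2
  have b10 : ⁅b 1, b 0⁆ = - b 2 := by rw [← lie_skew, b01]
  have b02 : ⁅b 0, b 2⁆ = b 1 := by rw [← lie_skew, b20, neg_neg]
  have b21 : ⁅b 2, b 1⁆ = 0 := by rw [← lie_skew, b12, neg_zero]
  refine ⟨e, f, !![0, -1, 0; -1, 0, 0; 0, 0, 0], !![1, 0, 0; 0, -1, 0; 0, 0, 0],
    ⟨?_, ?_, ?_⟩, ⟨?_, ?_, ?_⟩, ?_⟩
  · rw [e1, e2, add_lie, neg_lie, b10, b20]; simp [e0]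
  · rw [e0, e2, lie_add, b01, b02]; simp [e1]
  · rw [e0, e1]; simp [b12, b21]
  · rw [f1, f2, d20]; simp [f0]
  · rw [f2, f0, d01]; simp [f1]
  · rw [f0, f1, d12]; simp
  · intro c
    constructor <;> simp [divergence]

/-- The split is by which third divergence is non-zero: that summand is the `r_{3,μ}`. If neither
is, the trace-free blocks decide between abelian and `e(1,1)`. -/
theorem HalfFlatEqs.typeII_cases {a c s t : ℝ} {A B : Fin 3 → Fin 3 → ℝ}
    {e : Module.Basis (Fin 3) ℝ L₁} {f : Module.Basis (Fin 3) ℝ L₂} (hA : HasStructure e A)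
    (hB : HasStructure f B) (h : HalfFlatEqs a c s t A B) (ha : a ≠ 0) (hc : c ≠ 0)
    (hst : s ^ 2 ≠ t ^ 2) :
    (IsLieAbelian L₁ ∧ IsLieAbelian L₂) ∨ InTypeIIList L₁ L₂ ∨ InTypeIIList L₂ L₁ := by
  rw [inTypeIIList_iff, inTypeIIList_iff]
  by_cases hu : divergence A 2 = 0
  · by_cases hv : divergence B 2 = 0
    · obtain ⟨p, q, p', q', hA', hB', hiff⟩ := h.of_divergence_eq_zero ha hst hu hv
      by_cases hpq : p = 0 ∧ q = 0
      · have hpq' := hiff.mp hpq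
        refine Or.inl ⟨hA.isLieAbelian_iff.mpr ?_, hB.isLieAbelian_iff.mpr ?_⟩
        · rw [hA', hpq.1, hpq.2]
          intro i j; fin_cases i <;> fin_cases j <;> simp
        · rw [hB', hpq'.1, hpq'.2]
          intro i j; fin_cases i <;> fin_cases j <;> simp
      · exact Or.inr (Or.inl (Or.inl ⟨isE11_of_hasStructure (hA' ▸ hA) hpq,
          isE11_of_hasStructure (hB' ▸ hB) (mt hiff.mpr hpq)⟩))
    · obtain ⟨x, y, z, hxz, hB', hA'⟩ :=
        h.swap.of_divergence_ne_zero (neg_ne_zero.mpr ha) hc hst.symm hv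
      exact Or.inr (Or.inl (Or.inr
        (exists_isR3_of_hasStructure (neg_ne_zero.mpr ha) hxz (hB' ▸ hB) (hA' ▸ hA))))
  · obtain ⟨x, y, z, hxz, hA', hB'⟩ := h.of_divergence_ne_zero ha hc hst hu
    exact Or.inr (Or.inr (Or.inr (exists_isR3_of_hasStructure ha hxz (hA' ▸ hA) (hB' ▸ hB))))

theorem exists_typeII_iff (h₁ : Module.finrank ℝ L₁ = 3) (h₂ : Module.finrank ℝ L₂ = 3) :
    (∃ S : SL3RStructure (L₁ × L₂),
        S.IsHalfFlat ∧ S.SummandsOrthogonal ∧ S.SummandsDefinite ∧ S.IsTypeII) ↔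
      (IsLieAbelian L₁ ∧ IsLieAbelian L₂) ∨ InTypeIIList L₁ L₂ ∨ InTypeIIList L₂ L₁ := by
  constructor
  · rintro ⟨S, hflat, ho, hd, a, ha, hn⟩
    obtain ⟨e, f, s, t, A, B, hst, hA, hB, h⟩ :=
      (exists_hasNormalForm_iff a).mp ⟨S, hflat, ho, hd, hn⟩
    exact h.typeII_cases hA hB ha (by positivity) hst
  · intro H
    suffices hsuff : ∃ a : ℝ, a ≠ 0 ∧ ∃ S : SL3RStructure (L₁ × L₂),
        S.IsHalfFlat ∧ S.SummandsOrthogonal ∧ S.SummandsDefinite ∧ S.HasNormalForm a by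
      obtain ⟨a, ha, S, hS1, hS2, hS3, hS4⟩ := hsuff
      exact ⟨S, hS1, hS2, hS3, a, ha, hS4⟩
    simp only [exists_hasNormalForm_iff]
    rw [inTypeIIList_iff, inTypeIIList_iff] at H
    rcases H with ⟨a1, a2⟩ | (⟨h1, h2⟩ | ⟨μ, -, -, h2, h1⟩) | (⟨h2, h1⟩ | ⟨μ, -, -, h1, h2⟩)
    · have : Module.Finite ℝ L₁ := Module.finite_of_finrank_pos (by omega)
      have : Module.Finite ℝ L₂ := Module.finite_of_finrank_pos (by omega)
      set e := Module.finBasisOfFinrankEq ℝ L₁ h₁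
      set f := Module.finBasisOfFinrankEq ℝ L₂ h₂
      obtain ⟨A, hA⟩ := exists_hasStructure e
      obtain ⟨B, hB⟩ := exists_hasStructure f
      refine ⟨1, one_ne_zero, e, f, 1, 0, A, B, by norm_num, hA, hB, ?_⟩
      have hA0 := hA.isLieAbelian_iff.mp a1
      have hB0 := hB.isLieAbelian_iff.mp a2
      constructor <;> simp [divergence, hA0, hB0]
    · obtain ⟨e, f, A, B, hA, hB, h⟩ := exists_halfFlatEqs_of_isE11 h1 h2
      exact ⟨1, one_ne_zero, e, f, 1, 0, A, B, by norm_num, hA, hB, h _⟩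
    · obtain ⟨f, e, B, A, hB, hA, h⟩ := exists_halfFlatEqs_of_isR3 h2 h1
      -- The solution with `(a, s, t) = (1, 1, 0)` is found with the summands reversed; swapping
      -- them gives `(-1, 0, 1)`.
      exact ⟨-1, by norm_num, e, f, 0, 1, A, B, by norm_num, hA, hB, (h _).swap⟩
    · obtain ⟨e, f, A, B, hA, hB, h⟩ := exists_halfFlatEqs_of_isE11 h1 h2
      exact ⟨1, one_ne_zero, e, f, 1, 0, A, B, by norm_num, hA, hB, h _⟩
    · obtain ⟨e, f, A, B, hA, hB, h⟩ := exists_halfFlatEqs_of_isR3 h1 h2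
      exact ⟨1, one_ne_zero, e, f, 1, 0, A, B, by norm_num, hA, hB, h _⟩

end SL3RStructure

end Classification

theorem mainTheorem6 (L₁ L₂ : Type*) [LieRing L₁] [LieAlgebra ℝ L₁] [LieRing L₂]
    [LieAlgebra ℝ L₂] (h₁ : Module.finrank ℝ L₁ = 3) (h₂ : Module.finrank ℝ L₂ = 3) :
    ((∃ S : SL3RStructure (L₁ × L₂),
        S.IsHalfFlat ∧ S.SummandsOrthogonal ∧ S.SummandsDefinite ∧ S.IsTypeI) ↔
      (Nonempty (L₁ ≃ₗ⁅ℝ⁆ L₂) ∧ IsUnimodularLie L₁ ∧ IsUnimodularLie L₂) ∨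
      (¬ IsLieAbelian L₁ ∧ IsUnimodularLie L₁ ∧ IsLieAbelian L₂) ∨
      (IsLieAbelian L₁ ∧ ¬ IsLieAbelian L₂ ∧ IsUnimodularLie L₂)) ∧
    ((∃ S : SL3RStructure (L₁ × L₂),
        S.IsHalfFlat ∧ S.SummandsOrthogonal ∧ S.SummandsDefinite ∧ S.IsTypeII) ↔
      (IsLieAbelian L₁ ∧ IsLieAbelian L₂) ∨ InTypeIIList L₁ L₂ ∨ InTypeIIList L₂ L₁) :=
  ⟨SL3RStructure.exists_typeI_iff h₁ h₂, SL3RStructure.exists_typeII_iff h₁ h₂⟩
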